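/- Setting. Let $b$ be a prime, $m\in\mathbb N$, $N=b^m$, and let $f\in\mathbb F_b[x]$ be irreducible of degree $m$. Let $\alpha_1,\alpha_2>1$ be reals and let $(\gamma^{(1)}_j)_{j\ge1},(\gamma^{(2)}_j)_{j\ge1}$ be non-increasing sequences of positive reals. Put $e(v)=\exp(2\pi i v)$. For $k=\sum_i\kappa_ib^i\in\mathbb N_0$ and $x=\sum_{i\ge1}\xi_ib^{-i}\in[0,1)$ in base $b$ (infinitely many $\xi_i\ne b-1$), let $\mathrm{wal}_k(x)=e\big((\kappa_0\xi_1+\kappa_1\xi_2+\cdots)/b\big)$. Let $r^{(1)}_{\gamma}(0)=r^{(2)}_{\gamma}(0)=1$, $r^{(1)}_{\gamma}(k)=\gamma b^{-\alpha_1\lfloor\log_bk\rfloor}$ for $k\in\mathbb N$, and $r^{(2)}_{\gamma}(l)=\gamma|l|^{-\alpha_2}$ for $l\in\mathbb Z\setminus\{0\}$. For $d_1,d_2\in\mathbb N$, let $H_{d_1,d_2}$ be the space of functions $F$ on $[0,1)^{d_1+d_2}$ that are the sum of their series $F(x,y)=\sum_{k\in\mathbb N_0^{d_1},\,l\in\mathbb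 Z^{d_2}}\widehat F(k,l)\,\prod_j\mathrm{wal}_{k_j}(x_j)\,e(l\cdot y)$, where $\widehat F(k,l)=\int F(x,y)\,\overline{\prod_j\mathrm{wal}_{k_j}(x_j)\,e(l\cdot y)}\,dx\,dy$, and have finite norm $$\|F\|=\Big(\sum_{k,l}\prod_{j}r^{(1)}_{\gamma^{(1)}_j}(k_j)^{-1}\prod_{j}r^{(2)}_{\gamma^{(2)}_j}(l_j)^{-1}\,|\widehat F(k,l)|^2\Big)^{1/2}$$ (the tensor product of a weighted Walsh space and a weighted Korobov space). For $g\in\mathbb F_b[x]^{d_1}$ and $z\in\mathbb Z^{d_2}$, let $$e^2_{(d_1,d_2)}(g,z)=\sup_{F\in H_{d_1,d_2},\ \|F\|\le1}\Big|\int F-\frac1N\sum_{n=0}^{N-1}F(x_n,y_n)\Big|^2,$$ where $x_n=\big(\nu_m(n(x)g_j(x)/f(x))\big)_{j\le d_1}$, with $n(x)=\sum_i n_ix^i$ for $n=\sum_i n_ib^i$ in base $b$ and $\nu_m\big(\sum_l t_lx^{-l}\big)=\sum_{l=1}^m t_lb^{-l}$ for formal Laurent series over $\mathbb F_b$ in $x^{-1}$,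 and $y_n=\big(\{nz_j/N\}\big)_{j\le d_2}$. Algorithm. Let $s_1,s_2\in\mathbb N$, let $G_{b,m}$ be the set of polynomials in $\mathbb F_b[x]$ of degree less than $m$, and let $Z_N=\{z\in\{1,\dots,N-1\}:\gcd(z,N)=1\}$. Start with $d_1=d_2=1$, $g_1=1$ and some $z_1\in Z_N$ that minimizes $e^2_{(1,1)}(g_1,z_1)$. As long as $d_1<s_1$ or $d_2<s_2$, perform one of the following steps, in any order: if $d_1<s_1$, append to $g^*_{d_1}=(g_1,\dots,g_{d_1})$ some $g_{d_1+1}\in G_{b,m}$ that minimizes $e^2_{(d_1+1,d_2)}\big((g^*_{d_1},g_{d_1+1}),z^*_{d_2}\big)$ and increase $d_1$ by $1$; or, if $d_2<s_2$, append to $z^*_{d_2}=(z_1,\dots,z_{d_2})$ some $z_{d_2+1}\in Z_N$ that minimizes $e^2_{(d_1,d_2+1)}\big(g^*_{d_1},(z^*_{d_2},z_{d_2+1})\big)$ and increase $d_2$ by $1$. Theorem. Let $d_1\in\{1,\dots,s_1\}$ and $d_2\in\{1,\dots,s_2\}$. Then some run of the algorithm reaches the stage $(d_1,d_2)$, and whenever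 a run of the algorithm reaches the stage $(d_1,d_2)$, the vectors $g^*_{d_1}$ and $z^*_{d_2}$ constructed up to then satisfy $$e^2_{(d_1,d_2)}(g^*_{d_1},z^*_{d_2})\le\frac2N\prod_{j=1}^{d_1}\big(1+2\gamma^{(1)}_j\mu(\alpha_1)\big)\prod_{j=1}^{d_2}\big(1+4\gamma^{(2)}_j\zeta(\alpha_2)\big),$$ where $\mu(\alpha)=\dfrac{b^{\alpha}(b-1)}{b^{\alpha}-b}$ and $\zeta$ is the Riemann zeta function. -/

import Mathlib

open MeasureTheory
open scoped ENNReal Polynomial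

noncomputable section

namespace HybridCBC

/-! ### Walsh and trigonometric functions -/

/-- The `i`-th digit (`i = 0` is the units digit) of the natural number `k` in base `b`. -/
def natDigit (b k i : ℕ) : ℕ := k / b ^ i % b

/-- The digit `ξ_{i+1}` of `x = ∑_{i ≥ 1} ξ_i b^{-i} ∈ [0,1)` in base `b`, for the expansion in
which infinitely many digits differ from `b - 1`. -/
def realDigit (b : ℕ) (x : ℝ) (i : ℕ) : ℕ := ⌊x * (b : ℝ) ^ (i + 1)⌋₊ % b

/-- `e(v) = exp(2 π i v)`. -/
def ee (v : ℝ) : ℂ := Complex.exp (2 * Real.pi * Complex.I * v)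

/-- The `k`-th Walsh function in base `b`. -/
def wal (b k : ℕ) (x : ℝ) : ℂ :=
  ee ((∑ i ∈ Finset.range (Nat.log b k + 1), (realDigit b x i * natDigit b k i : ℝ)) / b)

/-- The Walsh function of a vector of indices. -/
def walVec (b : ℕ) {s : ℕ} (k : Fin s → ℕ) (x : Fin s → ℝ) : ℂ := ∏ j, wal b (k j) (x j)

/-- The trigonometric function `e_l(y) = exp(2 π i l · y)`. -/
def trigVec {s : ℕ} (l : Fin s → ℤ) (y : Fin s → ℝ) : ℂ := ee (∑ j, (l j : ℝ) * y j)

/-! ### Weights.  A sequence of weights `γ₁, γ₂, …` is a function `γ : ℕ → ℝ`, with `γ j`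
standing for `γ_{j+1}`. -/

/-- `1` for `k = 0`, and `γ b^{-α ⌊log_b k⌋}` for `k ≠ 0`. -/
def rWal (b : ℕ) (α γ : ℝ) (k : ℕ) : ℝ :=
  if k = 0 then 1 else γ * (b : ℝ) ^ (-(α * (Nat.log b k : ℝ)))

/-- `1` for `l = 0`, and `γ |l|^{-α}` for `l ≠ 0`. -/
def rKor (α γ : ℝ) (l : ℤ) : ℝ :=
  if l = 0 then 1 else γ * |(l : ℝ)| ^ (-α)

def rWalVec (b : ℕ) (α : ℝ) (γ : ℕ → ℝ) {s : ℕ} (k : Fin s → ℕ) : ℝ :=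
  ∏ j : Fin s, rWal b α (γ j) (k j)

def rKorVec (α : ℝ) (γ : ℕ → ℝ) {s : ℕ} (l : Fin s → ℤ) : ℝ :=
  ∏ j : Fin s, rKor α (γ j) (l j)

/-! ### The hybrid function space -/

/-- The half-open unit cube `[0,1)^{s₁} × [0,1)^{s₂}`. -/
def cube (s₁ s₂ : ℕ) : Set ((Fin s₁ → ℝ) × (Fin s₂ → ℝ)) :=
  (Set.univ.pi fun _ => Set.Ico 0 1) ×ˢ (Set.univ.pi fun _ => Set.Ico 0 1)

/-- The basis function `(x, y) ↦ wal_k(x) e_l(y)`. -/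
def basisFun (b : ℕ) {s₁ s₂ : ℕ} (kl : (Fin s₁ → ℕ) × (Fin s₂ → ℤ))
    (p : (Fin s₁ → ℝ) × (Fin s₂ → ℝ)) : ℂ :=
  walVec b kl.1 p.1 * trigVec kl.2 p.2

/-- The coefficient `f̂(k, l)`. -/
def coeff (b : ℕ) {s₁ s₂ : ℕ} (f : (Fin s₁ → ℝ) × (Fin s₂ → ℝ) → ℂ)
    (kl : (Fin s₁ → ℕ) × (Fin s₂ → ℤ)) : ℂ :=
  ∫ p in cube s₁ s₂, f p * (starRingEnd ℂ) (basisFun b kl p)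

/-- The summand `r⁽¹⁾(k)⁻¹ r⁽²⁾(l)⁻¹ |f̂(k, l)|²` of the squared norm of `f`. -/
def normSummand (b : ℕ) (α₁ α₂ : ℝ) (γ₁ γ₂ : ℕ → ℝ) {s₁ s₂ : ℕ}
    (f : (Fin s₁ → ℝ) × (Fin s₂ → ℝ) → ℂ) (kl : (Fin s₁ → ℕ) × (Fin s₂ → ℤ)) : ℝ :=
  (rWalVec b α₁ γ₁ kl.1)⁻¹ * (rKorVec α₂ γ₂ kl.2)⁻¹ * ‖coeff b f kl‖ ^ 2

/-- Membership of `f` in the hybrid space, the tensor product of the weighted Walsh space and the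
weighted Korobov space: `f` is, on the unit cube, the sum of its Walsh-Fourier series, and its norm
is finite.  Only the values of `f` on the unit cube matter. -/
structure MemHybrid (b : ℕ) (α₁ α₂ : ℝ) (γ₁ γ₂ : ℕ → ℝ) {s₁ s₂ : ℕ}
    (f : (Fin s₁ → ℝ) × (Fin s₂ → ℝ) → ℂ) : Prop where
  integrableOn : IntegrableOn f (cube s₁ s₂)
  hasSum : ∀ p ∈ cube s₁ s₂, HasSum (fun kl => coeff b f kl * basisFun b kl p) (f p)
  summable : Summable (normSummand b α₁ α₂ γ₁ γ₂ f)

/-- The norm of the hybrid space. -/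
def hybridNorm (b : ℕ) (α₁ α₂ : ℝ) (γ₁ γ₂ : ℕ → ℝ) {s₁ s₂ : ℕ}
    (f : (Fin s₁ → ℝ) × (Fin s₂ → ℝ) → ℂ) : ℝ :=
  Real.sqrt (∑' kl, normSummand b α₁ α₂ γ₁ γ₂ f kl)

/-- The worst-case error, over the unit ball of the hybrid space, of the quasi-Monte Carlo rule
with nodes `P 0, …, P (N - 1)`. -/
def worstCaseError (b : ℕ) (α₁ α₂ : ℝ) (γ₁ γ₂ : ℕ → ℝ) {s₁ s₂ : ℕ} (N : ℕ)
    (P : ℕ → (Fin s₁ → ℝ) × (Fin s₂ → ℝ)) : ℝ≥0∞ :=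
  ⨆ (f : (Fin s₁ → ℝ) × (Fin s₂ → ℝ) → ℂ) (_ : MemHybrid b α₁ α₂ γ₁ γ₂ f)
    (_ : hybridNorm b α₁ α₂ γ₁ γ₂ f ≤ 1),
    ‖(∫ p in cube s₁ s₂, f p) - (1 / (N : ℂ)) * ∑ n ∈ Finset.range N, f (P n)‖ₑ

/-! ### Lattice and polynomial lattice point sets -/

section Points

variable (b : ℕ) [Fact b.Prime]

/-- The embedding of `𝔽_b[x]` into the field `𝔽_b((x⁻¹))` of formal Laurent series in `x⁻¹`,
realised as Laurent series in a variable `T = x⁻¹`: it sends `x` to `T⁻¹`. -/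
def toLaurent : (ZMod b)[X] →+* LaurentSeries (ZMod b) :=
  Polynomial.eval₂RingHom HahnSeries.C (HahnSeries.single (-1 : ℤ) (1 : ZMod b))

/-- `ν_m(∑_l t_l x^{-l}) = ∑_{l=1}^m t_l b^{-l}`. -/
def nu (m : ℕ) (L : LaurentSeries (ZMod b)) : ℝ :=
  ∑ l ∈ Finset.Icc 1 m, ((L.coeff (l : ℤ)).val : ℝ) * ((b : ℝ) ^ l)⁻¹

/-- The polynomial `n(x) = ∑_{i<m} n_i x^i` with `n = ∑_{i<m} n_i b^i`, for `0 ≤ n < b^m`. -/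
def natPoly (m n : ℕ) : (ZMod b)[X] :=
  ∑ i ∈ Finset.range m, Polynomial.C (natDigit b n i : ZMod b) * Polynomial.X ^ i

/-- The `n`-th point of the polynomial lattice with modulus `f` and generating vector `g`. -/
def polyLatticePoint (m : ℕ) (f : (ZMod b)[X]) {s : ℕ} (g : Fin s → (ZMod b)[X]) (n : ℕ) :
    Fin s → ℝ :=
  fun j => nu b m (toLaurent b (natPoly b m n * g j) / toLaurent b f)

/-- The `n`-th point of the `N`-point lattice with generating vector `z`. -/
def latticePoint (N : ℕ) {s : ℕ} (z : Fin s → ℤ) (n : ℕ) : Fin s → ℝ :=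
  fun j => Int.fract ((n : ℝ) * (z j : ℝ) / (N : ℝ))

/-- The squared worst-case error `e²(g, z)` of the hybrid point set of `N = b^m` points generated
by `g` (polynomial lattice part) and `z` (lattice part). -/
def errSq (α₁ α₂ : ℝ) (γ₁ γ₂ : ℕ → ℝ) (m : ℕ) (f : (ZMod b)[X]) {d₁ d₂ : ℕ}
    (g : Fin d₁ → (ZMod b)[X]) (z : Fin d₂ → ℤ) : ℝ≥0∞ :=
  (worstCaseError b α₁ α₂ γ₁ γ₂ (b ^ m)
    (fun n => (polyLatticePoint b m f g n, latticePoint (b ^ m) z n))) ^ 2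

/-- `G_{b,m}`: the polynomials over `𝔽_b` of degree less than `m`. -/
def genPoly (m : ℕ) : Set (ZMod b)[X] := {g | g.degree < (m : WithBot ℕ)}

/-- `Z_N`: the integers in `{1, …, N - 1}` that are coprime to `N`. -/
def genInt (N : ℕ) : Set ℤ := {z | 1 ≤ z ∧ z < N ∧ IsCoprime z (N : ℤ)}

/-- `CBC … d₁ d₂ g z` says that some run of the component-by-component algorithm with final
dimensions `s₁, s₂` reaches a stage at which the generating vectors constructed so far are
`g = (g₁, …, g_{d₁})` and `z = (z₁, …, z_{d₂})`.  All admissible orders of the two kinds of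
extension steps, and all choices between several minimizers, are allowed. -/
inductive CBC (α₁ α₂ : ℝ) (γ₁ γ₂ : ℕ → ℝ) (m : ℕ) (f : (ZMod b)[X]) (s₁ s₂ : ℕ) :
    (d₁ d₂ : ℕ) → (Fin d₁ → (ZMod b)[X]) → (Fin d₂ → ℤ) → Prop
  | start (z₁ : ℤ) (hz : z₁ ∈ genInt (b ^ m))
      (hmin : ∀ z ∈ genInt (b ^ m),
        errSq b α₁ α₂ γ₁ γ₂ m f (fun _ : Fin 1 => 1) (fun _ : Fin 1 => z₁) ≤
          errSq b α₁ α₂ γ₁ γ₂ m f (fun _ : Fin 1 => 1) (fun _ : Fin 1 => z)) :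
      CBC α₁ α₂ γ₁ γ₂ m f s₁ s₂ 1 1 (fun _ => 1) (fun _ => z₁)
  | extendPoly {d₁ d₂ : ℕ} (g : Fin d₁ → (ZMod b)[X]) (z : Fin d₂ → ℤ)
      (h : CBC α₁ α₂ γ₁ γ₂ m f s₁ s₂ d₁ d₂ g z) (hd : d₁ < s₁)
      (gNew : (ZMod b)[X]) (hg : gNew ∈ genPoly b m)
      (hmin : ∀ g' ∈ genPoly b m,
        errSq b α₁ α₂ γ₁ γ₂ m f (Fin.snoc (α := fun _ => (ZMod b)[X]) g gNew) z ≤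
          errSq b α₁ α₂ γ₁ γ₂ m f (Fin.snoc (α := fun _ => (ZMod b)[X]) g g') z) :
      CBC α₁ α₂ γ₁ γ₂ m f s₁ s₂ (d₁ + 1) d₂ (Fin.snoc (α := fun _ => (ZMod b)[X]) g gNew) z
  | extendInt {d₁ d₂ : ℕ} (g : Fin d₁ → (ZMod b)[X]) (z : Fin d₂ → ℤ)
      (h : CBC α₁ α₂ γ₁ γ₂ m f s₁ s₂ d₁ d₂ g z) (hd : d₂ < s₂)
      (zNew : ℤ) (hz : zNew ∈ genInt (b ^ m))
      (hmin : ∀ z' ∈ genInt (b ^ m),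
        errSq b α₁ α₂ γ₁ γ₂ m f g (Fin.snoc (α := fun _ => ℤ) z zNew) ≤
          errSq b α₁ α₂ γ₁ γ₂ m f g (Fin.snoc (α := fun _ => ℤ) z z')) :
      CBC α₁ α₂ γ₁ γ₂ m f s₁ s₂ d₁ (d₂ + 1) g (Fin.snoc (α := fun _ => ℤ) z zNew)

end Points

/-- `μ(α) = b^α (b - 1) / (b^α - b)`. -/
def mu (b : ℕ) (α : ℝ) : ℝ := (b : ℝ) ^ α * ((b : ℝ) - 1) / ((b : ℝ) ^ α - (b : ℝ))

/-- The value `ζ(α)` of the Riemann zeta function at a real point, as a real number. -/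
def zetaReal (α : ℝ) : ℝ := (riemannZeta (α : ℂ)).re

end HybridCBC

end

namespace HybridCBC

/-! ### Characters and digits -/

/-! The functions `wal_k(x) e_l(y)` are orthonormal on the cube, so the quadrature error is a linear
functional whose squared norm is a weighted sum. By Cauchy–Schwarz, and its equality case on finite
sums of basis functions, `e² + 1 = ∑ r(k) r(l) |M(k,l)|²`, with `M(k,l)` the mean of the basis
function over the nodes (`worstCaseError_sq_add_one`). This holds in `ℝ≥0∞`, so convergence is never
an issue.

The nodes do not form a group compatible with both kinds of characters, so `M(k,l)` is not an
indicator of a dual lattice. The argument only uses that the old components contribute some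
unimodular sequence `φ(n)`, which a new component multiplies by a character `χ(n)`. The zero index
of the new component gives back the old error. The nonzero indices are averaged over all candidates,
and the minimizer is at most the average.

Polynomial step: if `b^m ∤ k`, the characters are orthogonal under summation over all `b^m`
generators, since `f` is irreducible, and the mean squares add up to `1`; if `b^m ∣ k`, each is at
most `1`. As `∑ decay(k) (1 + N·[N ∣ k]) ≤ 2μ`, the error grows by at most `2γμ/N` times the total
weight (`errSq_snoc_left_le`).

Integer step: `W(t) = |N⁻¹ ∑ φ(n) e(nt/N)|²` has total mass `1` on `ZMod N`, and `l z = t` has at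
most `gcd(t,N)` solutions `z` in `Z_N`, none unless `gcd(t,N) ∣ l`. Hence the sum over `l` and `z`
is at most `2ζ`. Since `|Z_N| ≥ N/2`, the growth is at most `4γζ/N` times the total weight
(`errSq_snoc_right_le`).

The total weight is at most the product in the claim (`tsum_weight_le`), so each increment is at
most the growth of the claimed bound, and induction along the run finishes (`errSq_le_of_CBC`). -/

lemma ee_zero : ee 0 = 1 := by simp [ee]

lemma ee_add (u v : ℝ) : ee (u + v) = ee u * ee v := by
  simp only [ee, ← Complex.exp_add]
  push_cast
  ring_nf

lemma norm_ee (v : ℝ) : ‖ee v‖ = 1 := by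
  have : (2 * Real.pi * Complex.I * v : ℂ) = ((2 * Real.pi * v : ℝ) : ℂ) * Complex.I := by
    push_cast; ring
  rw [ee, this, Complex.norm_exp_ofReal_mul_I]

lemma conj_ee (v : ℝ) : (starRingEnd ℂ) (ee v) = ee (-v) := by
  rw [ee, ← Complex.exp_conj, ee]
  congr 1
  simp [map_ofNat (starRingEnd ℂ) 2]

lemma ee_int (n : ℤ) : ee n = 1 := by
  rw [ee, Complex.exp_eq_one_iff]
  exact ⟨n, by push_cast; ring⟩

lemma continuous_ee : Continuous ee := by
  unfold ee
  fun_prop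

lemma ee_sum {ι : Type*} (s : Finset ι) (u : ι → ℝ) : ee (∑ i ∈ s, u i) = ∏ i ∈ s, ee (u i) := by
  classical
  induction s using Finset.induction_on with
  | empty => simp [ee_zero]
  | insert a s ha ih => rw [Finset.sum_insert ha, Finset.prod_insert ha, ee_add, ih]

lemma natDigit_eq_zero {b k i M : ℕ} (hk : k < b ^ M) (hb : 0 < b) (hi : M ≤ i) :
    natDigit b k i = 0 := by
  rw [natDigit, Nat.div_eq_of_lt (hk.trans_le (Nat.pow_le_pow_right hb hi)), Nat.zero_mod]

/-- Digits of `k` beyond its length vanish, so the cut-off is immaterial; this frees later arguments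
from `Nat.log`. -/
lemma wal_eq_of_lt {b k M : ℕ} (hb : 1 < b) (hk : k < b ^ M) (x : ℝ) :
    wal b k x =
      ee ((∑ i ∈ Finset.range M, (realDigit b x i * natDigit b k i : ℝ)) / b) := by
  have key : ∀ A B : ℕ, k < b ^ A → A ≤ B →
      (∑ i ∈ Finset.range A, (realDigit b x i * natDigit b k i : ℝ)) =
        ∑ i ∈ Finset.range B, (realDigit b x i * natDigit b k i : ℝ) := by
    intro A B hA hAB
    refine Finset.sum_subset (Finset.range_mono hAB) fun i _ hi => ?_
    rw [natDigit_eq_zero hA (by omega) (by simpa using hi)]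
    simp
  have hlog : k < b ^ (Nat.log b k + 1) := Nat.lt_pow_succ_log_self hb k
  rw [wal]
  rcases le_total (Nat.log b k + 1) M with h | h
  · rw [key _ _ hlog h]
  · rw [key _ _ hk h]

lemma wal_zero (b : ℕ) (x : ℝ) : wal b 0 x = 1 := by
  simp [wal, natDigit, ee_zero]

lemma norm_wal (b k : ℕ) (x : ℝ) : ‖wal b k x‖ = 1 := norm_ee _

lemma measurable_wal (b k : ℕ) : Measurable (wal b k) := by
  unfold wal realDigit
  refine continuous_ee.measurable.comp (Measurable.div_const ?_ _)
  refine Finset.measurable_fun_sum _ fun i _ => Measurable.mul_const ?_ _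
  refine measurable_from_nat.comp (f := fun x : ℝ => ⌊x * (b : ℝ) ^ (i + 1)⌋₊)
    (g := fun n : ℕ => ((n % b : ℕ) : ℝ)) ?_
  exact Nat.measurable_floor.comp (by fun_prop)

lemma realDigit_add_div_zero {b c : ℕ} (hc : c < b) {y : ℝ} (hy : y ∈ Set.Ico (0 : ℝ) 1) :
    realDigit b ((c + y) / b) 0 = c := by
  have hb : (b : ℝ) ≠ 0 := by
    have : 0 < b := by omega
    positivity
  have h : ((c + y) / b * (b : ℝ) ^ (0 + 1)) = y + c := by field_simp; ring
  rw [realDigit, h, Nat.floor_add_natCast hy.1, Nat.floor_eq_zero.2 hy.2, zero_add,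
    Nat.mod_eq_of_lt hc]

lemma realDigit_add_div_succ {b c : ℕ} (hb0 : 0 < b) {y : ℝ} (hy : y ∈ Set.Ico (0 : ℝ) 1)
    (i : ℕ) : realDigit b ((c + y) / b) (i + 1) = realDigit b y i := by
  have hb : (b : ℝ) ≠ 0 := by positivity
  have h : ((c + y) / b * (b : ℝ) ^ (i + 1 + 1)) =
      y * (b : ℝ) ^ (i + 1) + ((c * b ^ i * b : ℕ) : ℝ) := by
    push_cast
    field_simp
    ring
  rw [realDigit, h, Nat.floor_add_natCast (mul_nonneg hy.1 (by positivity)),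
    Nat.add_mul_mod_self_right, realDigit]

/-- Self-similarity: prepending a digit `c` to `y` pairs `c` with the last digit of `k` and shifts
the remaining digits. Orthogonality and the evaluation at finite expansions both follow from it by
recursion. -/
lemma wal_add_div {b c : ℕ} (hb : 1 < b) (hc : c < b) (k : ℕ) {y : ℝ}
    (hy : y ∈ Set.Ico (0 : ℝ) 1) :
    wal b k ((c + y) / b) = ee (c * (k % b : ℕ) / b) * wal b (k / b) y := by
  obtain ⟨M, hM⟩ : ∃ M, k / b < b ^ M := ⟨_, Nat.lt_pow_succ_log_self hb _⟩
  have hk : k < b ^ (M + 1) := by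
    rw [pow_succ]
    exact Nat.lt_mul_of_div_lt hM (by omega)
  rw [wal_eq_of_lt hb hk, wal_eq_of_lt hb hM, ← ee_add, Finset.sum_range_succ',
    realDigit_add_div_zero hc hy, ← add_div, add_comm]
  congr 2
  simp only [realDigit_add_div_succ (by omega : 0 < b) hy, natDigit, pow_zero, Nat.div_one,
    pow_succ', Nat.div_div_eq_div_mul]

/-! ### Orthonormality -/

lemma integral_Ico_eq_sum {b : ℕ} (hb : 0 < b) {h : ℝ → ℂ}
    (hint : IntegrableOn h (Set.Ico 0 1)) :
    ∫ x in Set.Ico (0 : ℝ) 1, h x =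
      (1 / (b : ℂ)) * ∑ c ∈ Finset.range b, ∫ y in Set.Ico (0 : ℝ) 1, h ((c + y) / b) := by
  have hb' : (b : ℝ) ≠ 0 := by positivity
  have conv : ∀ u : ℝ → ℂ, ∫ x in Set.Ico (0 : ℝ) 1, u x = ∫ x in (0 : ℝ)..1, u x := by
    intro u
    rw [integral_Ico_eq_integral_Ioo, ← integral_Ioc_eq_integral_Ioo,
      intervalIntegral.integral_of_le zero_le_one]
  simp only [conv]
  have hI : IntegrableOn h (Set.Icc 0 1) := by
    rwa [integrableOn_Icc_iff_integrableOn_Ico]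
  have hadj := intervalIntegral.sum_integral_adjacent_intervals (f := h) (μ := volume)
    (a := fun c : ℕ => (c : ℝ) / b) (n := b) (by
      intro k hk
      refine IntegrableOn.intervalIntegrable (hI.mono_set ?_)
      have h1 : ((k + 1 : ℕ) : ℝ) ≤ b := by exact_mod_cast hk
      have h2 : (k : ℝ) / b ≤ ((k + 1 : ℕ) : ℝ) / b := by
        gcongr
        exact_mod_cast Nat.le_succ k
      rw [Set.uIcc_of_le h2]
      refine Set.Icc_subset_Icc (by positivity) ?_
      rw [div_le_one (by positivity)]
      exact h1)
  simp only [Nat.cast_zero, zero_div, div_self hb'] at hadj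
  rw [← hadj, Finset.mul_sum]
  refine Finset.sum_congr rfl fun c _ => ?_
  have hs := intervalIntegral.integral_comp_add_div (f := h) (a := 0) (b := 1) hb' ((c : ℝ) / b)
  have h2 : ∀ y : ℝ, ((c : ℝ) + y) / b = c / b + y / b := fun y => add_div _ _ _
  simp only [h2, hs, zero_div, add_zero]
  rw [show ((c : ℝ) / b + 1 / b) = ((c + 1 : ℕ) : ℝ) / b by push_cast; ring]
  rw [Complex.real_smul, ← mul_assoc]
  push_cast
  rw [one_div, inv_mul_cancel₀ (by exact_mod_cast hb'), one_mul]

instance : IsProbabilityMeasure (volume.restrict (Set.Ico (0 : ℝ) 1)) :=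
  ⟨by simp⟩

lemma integrableOn_of_norm_eq_one {h : ℝ → ℂ} (hm : Measurable h) (h1 : ∀ x, ‖h x‖ = 1) :
    IntegrableOn h (Set.Ico 0 1) :=
  Integrable.of_bound hm.aestronglyMeasurable 1 (Filter.Eventually.of_forall fun x => (h1 x).le)

lemma sum_ee_mul_conj {b : ℕ} (hb : 0 < b) {u v : ℕ} (hu : u < b) (hv : v < b) :
    ∑ c ∈ Finset.range b, ee (c * u / b) * (starRingEnd ℂ) (ee (c * v / b)) =
      if u = v then (b : ℂ) else 0 := by
  have hb' : (b : ℝ) ≠ 0 := by positivity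
  split_ifs with h
  · subst h
    simp [Complex.mul_conj', norm_ee]
  · set ζ := ee (((u : ℝ) - v) / b) with hζ
    have hterm : ∀ c : ℕ, ee (c * u / b) * (starRingEnd ℂ) (ee (c * v / b)) = ζ ^ c := by
      intro c
      rw [conj_ee, ← ee_add, hζ, ee, ee, ← Complex.exp_nat_mul]
      congr 1
      push_cast
      ring
    simp only [hterm]
    have hpow : ζ ^ b = 1 := by
      rw [hζ, ee, ← Complex.exp_nat_mul]
      have := ee_int ((u : ℤ) - v)
      rw [ee] at this
      rw [← this]
      congr 1
      have : (b : ℂ) ≠ 0 := by exact_mod_cast hb'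
      push_cast
      field_simp
    have hne : ζ ≠ 1 := by
      intro h1
      rw [hζ, ee, Complex.exp_eq_one_iff] at h1
      obtain ⟨n, hn⟩ := h1
      have h2 : (2 * Real.pi * Complex.I : ℂ) ≠ 0 := Complex.two_pi_I_ne_zero
      have h3 : ((((u : ℝ) - v) / b : ℝ) : ℂ) = n := by
        apply mul_left_cancel₀ h2
        rw [hn]; ring
      have h4 : (((u : ℝ) - v) / b : ℝ) = n := by exact_mod_cast h3
      rw [div_eq_iff hb'] at h4
      have h5 : (u : ℤ) - v = n * b := by exact_mod_cast h4
      have h6 : (b : ℤ) ∣ (u : ℤ) - v := ⟨n, by rw [h5]; ring⟩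
      -- Both digits lie in `[0, b)`, so `|u - v| < b`.
      have h7 := Int.eq_zero_of_abs_lt_dvd h6 (by rw [abs_lt]; omega)
      omega
    have := mul_neg_geom_sum ζ b
    rw [hpow, sub_self] at this
    exact (mul_eq_zero.1 this).resolve_left (sub_ne_zero.2 hne.symm)

/-- Splitting `[0,1)` according to the first digit `c`, the sum over `c` tests the last digits of
`k` and `k'`, and the remaining integral is the same statement for `k / b` and `k' / b`. The sum `k
+ k'` drops strictly unless both are zero. -/
lemma integral_wal_mul_conj {b : ℕ} (hb : 1 < b) (k k' : ℕ) :
    ∫ x in Set.Ico (0 : ℝ) 1, wal b k x * (starRingEnd ℂ) (wal b k' x) =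
      if k = k' then 1 else 0 := by
  induction hn : k + k' using Nat.strong_induction_on generalizing k k' with
  | _ n ih =>
    subst hn
    rcases Nat.eq_zero_or_pos (k + k') with h0 | h0
    · obtain ⟨rfl, rfl⟩ : k = 0 ∧ k' = 0 := by omega
      simp [wal_zero]
    · have hlt : k / b + k' / b < k + k' := by
        rcases Nat.eq_zero_or_pos k with rfl | hk
        · simpa using Nat.div_lt_self (by omega) hb
        · have := Nat.div_lt_self hk hb
          have := Nat.div_le_self k' b
          omega
      have hb' : (b : ℂ) ≠ 0 := by
        have : b ≠ 0 := by omega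
        exact_mod_cast this
      rw [integral_Ico_eq_sum (b := b)
        (h := fun x => wal b k x * (starRingEnd ℂ) (wal b k' x)) (by omega) (integrableOn_of_norm_eq_one
        ((measurable_wal b k).mul (Complex.continuous_conj.measurable.comp (measurable_wal b k')))
        (fun x => by simp [norm_wal]))]
      have hstep : ∀ c ∈ Finset.range b, ∫ y in Set.Ico (0 : ℝ) 1,
          wal b k ((c + y) / b) * (starRingEnd ℂ) (wal b k' ((c + y) / b)) =
          (ee (c * (k % b : ℕ) / b) * (starRingEnd ℂ) (ee (c * (k' % b : ℕ) / b))) *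
            (if k / b = k' / b then 1 else 0) := by
        intro c hc
        rw [← ih _ hlt (k / b) (k' / b) rfl, ← integral_const_mul]
        refine setIntegral_congr_fun measurableSet_Ico fun y hy => ?_
        simp only [wal_add_div hb (Finset.mem_range.1 hc) _ hy, map_mul]
        ring
      rw [Finset.sum_congr rfl hstep, ← Finset.sum_mul,
        sum_ee_mul_conj (by omega) (Nat.mod_lt _ (by omega)) (Nat.mod_lt _ (by omega))]
      by_cases hkk : k = k'
      · subst hkk
        simp [hb']
      · rw [if_neg hkk]
        by_cases h1 : k % b = k' % b
        · have h2 : k / b ≠ k' / b := by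
            intro h2
            exact hkk (by rw [← Nat.div_add_mod k b, ← Nat.div_add_mod k' b, h1, h2])
          simp [h2]
        · simp [h1]

lemma integral_ee_mul_conj (l l' : ℤ) :
    ∫ y in Set.Ico (0 : ℝ) 1, ee (l * y) * (starRingEnd ℂ) (ee (l' * y)) =
      if l = l' then 1 else 0 := by
  split_ifs with h
  · subst h
    simp [Complex.mul_conj', norm_ee]
  · rw [integral_Ico_eq_integral_Ioo, ← integral_Ioc_eq_integral_Ioo,
      ← intervalIntegral.integral_of_le zero_le_one]
    have hc : (2 * Real.pi * Complex.I * ((l : ℂ) - l') : ℂ) ≠ 0 := by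
      refine mul_ne_zero Complex.two_pi_I_ne_zero (sub_ne_zero.2 ?_)
      exact_mod_cast h
    have hf : ∀ y : ℝ, ee (l * y) * (starRingEnd ℂ) (ee (l' * y)) =
        Complex.exp (2 * Real.pi * Complex.I * ((l : ℂ) - l') * y) := by
      intro y
      rw [conj_ee, ← ee_add, ee]
      congr 1
      push_cast
      ring
    simp only [hf]
    rw [integral_exp_mul_complex hc]
    have := ee_int (l - l')
    rw [ee] at this
    push_cast at this ⊢
    rw [mul_one, this]
    simp

lemma volume_restrict_cube (s₁ s₂ : ℕ) :
    (volume : Measure ((Fin s₁ → ℝ) × (Fin s₂ → ℝ))).restrict (cube s₁ s₂) =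
      (Measure.pi fun _ => volume.restrict (Set.Ico 0 1)).prod
        (Measure.pi fun _ => volume.restrict (Set.Ico 0 1)) := by
  rw [cube, Measure.volume_eq_prod, ← Measure.prod_restrict, volume_pi, volume_pi,
    Measure.restrict_pi_pi, Measure.restrict_pi_pi]

instance (s₁ s₂ : ℕ) : IsProbabilityMeasure
    ((volume : Measure ((Fin s₁ → ℝ) × (Fin s₂ → ℝ))).restrict (cube s₁ s₂)) := by
  rw [volume_restrict_cube]
  infer_instance

lemma trigVec_eq_prod {s : ℕ} (l : Fin s → ℤ) (y : Fin s → ℝ) :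
    trigVec l y = ∏ j, ee (l j * y j) := by
  rw [trigVec, ee_sum]

lemma measurable_basisFun (b : ℕ) {s₁ s₂ : ℕ} (kl : (Fin s₁ → ℕ) × (Fin s₂ → ℤ)) :
    Measurable (basisFun b kl) := by
  unfold basisFun walVec
  refine Measurable.mul ?_ ?_
  · refine Finset.measurable_fun_prod _ fun j _ => ?_
    exact (measurable_wal b (kl.1 j)).comp (by fun_prop)
  · exact continuous_ee.measurable.comp (by fun_prop)

lemma norm_basisFun (b : ℕ) {s₁ s₂ : ℕ} (kl : (Fin s₁ → ℕ) × (Fin s₂ → ℤ))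
    (p : (Fin s₁ → ℝ) × (Fin s₂ → ℝ)) : ‖basisFun b kl p‖ = 1 := by
  simp [basisFun, walVec, trigVec, norm_wal, norm_ee]

lemma basisFun_zero (b : ℕ) {s₁ s₂ : ℕ} (p : (Fin s₁ → ℝ) × (Fin s₂ → ℝ)) :
    basisFun b (0 : (Fin s₁ → ℕ) × (Fin s₂ → ℤ)) p = 1 := by
  simp [basisFun, walVec, trigVec, wal_zero, ee_zero]

lemma coeff_zero (b : ℕ) {s₁ s₂ : ℕ} (f : (Fin s₁ → ℝ) × (Fin s₂ → ℝ) → ℂ) :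
    coeff b f 0 = ∫ p in cube s₁ s₂, f p := by
  simp [coeff, basisFun_zero]

lemma integral_basisFun_mul_conj {b : ℕ} (hb : 1 < b) {s₁ s₂ : ℕ}
    (kl kl' : (Fin s₁ → ℕ) × (Fin s₂ → ℤ)) :
    ∫ p in cube s₁ s₂, basisFun b kl p * (starRingEnd ℂ) (basisFun b kl' p) =
      if kl = kl' then 1 else 0 := by
  have hfun : ∀ p : (Fin s₁ → ℝ) × (Fin s₂ → ℝ),
      basisFun b kl p * (starRingEnd ℂ) (basisFun b kl' p) =
        (∏ j, wal b (kl.1 j) (p.1 j) * (starRingEnd ℂ) (wal b (kl'.1 j) (p.1 j))) *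
        ∏ j, ee (kl.2 j * p.2 j) * (starRingEnd ℂ) (ee (kl'.2 j * p.2 j)) := by
    intro p
    simp only [basisFun, walVec, trigVec_eq_prod, map_mul, map_prod, Finset.prod_mul_distrib]
    ring
  simp only [hfun]
  rw [volume_restrict_cube, integral_prod_mul
    (f := fun x : Fin s₁ → ℝ =>
      ∏ j, wal b (kl.1 j) (x j) * (starRingEnd ℂ) (wal b (kl'.1 j) (x j)))
    (g := fun y : Fin s₂ → ℝ => ∏ j, ee (kl.2 j * y j) * (starRingEnd ℂ) (ee (kl'.2 j * y j))),
    integral_fintype_prod_eq_prod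
      (f := fun j x => wal b (kl.1 j) x * (starRingEnd ℂ) (wal b (kl'.1 j) x)),
    integral_fintype_prod_eq_prod
      (f := fun j y => ee (kl.2 j * y) * (starRingEnd ℂ) (ee (kl'.2 j * y)))]
  simp only [integral_wal_mul_conj hb, integral_ee_mul_conj, Finset.prod_ite_zero]
  simp only [Prod.ext_iff, funext_iff, Finset.mem_univ, true_implies, Finset.prod_const_one]
  by_cases h1 : ∀ j, kl.1 j = kl'.1 j <;> by_cases h2 : ∀ j, kl.2 j = kl'.2 j <;> simp [h1, h2]

lemma integrableOn_basisFun (b : ℕ) {s₁ s₂ : ℕ} (kl : (Fin s₁ → ℕ) × (Fin s₂ → ℤ)) :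
    IntegrableOn (basisFun b kl) (cube s₁ s₂) :=
  Integrable.of_bound (measurable_basisFun b kl).aestronglyMeasurable 1
    (Filter.Eventually.of_forall fun p => (norm_basisFun b kl p).le)

/-- The coefficients of a finite linear combination of basis functions. -/
lemma coeff_sum_basisFun {b : ℕ} (hb : 1 < b) {s₁ s₂ : ℕ}
    (s : Finset ((Fin s₁ → ℕ) × (Fin s₂ → ℤ))) (a : (Fin s₁ → ℕ) × (Fin s₂ → ℤ) → ℂ)
    (kl : (Fin s₁ → ℕ) × (Fin s₂ → ℤ)) :
    coeff b (fun p => ∑ i ∈ s, a i * basisFun b i p) kl = if kl ∈ s then a kl else 0 := by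
  rw [coeff]
  simp only [Finset.sum_mul, mul_assoc]
  rw [integral_finsetSum]
  · simp only [integral_const_mul, integral_basisFun_mul_conj hb, mul_ite, mul_one, mul_zero]
    rw [Finset.sum_ite_eq']
  · intro i _
    refine Integrable.const_mul ?_ _
    refine Integrable.of_bound (Measurable.aestronglyMeasurable ?_) 1
      (Filter.Eventually.of_forall fun p => ?_)
    · exact (measurable_basisFun b i).mul
        (Complex.continuous_conj.measurable.comp (measurable_basisFun b kl))
    · simp [norm_basisFun]

/-! ### The worst-case error as a weighted sum -/

/-- The weight `r⁽¹⁾(k) r⁽²⁾(l)`. -/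
noncomputable def weight (b : ℕ) (α₁ α₂ : ℝ) (γ₁ γ₂ : ℕ → ℝ) {s₁ s₂ : ℕ}
    (kl : (Fin s₁ → ℕ) × (Fin s₂ → ℤ)) : ℝ :=
  rWalVec b α₁ γ₁ kl.1 * rKorVec α₂ γ₂ kl.2

/-- The mean of the basis function `wal_k e_l` over the nodes `P 0, …, P (N - 1)`. -/
noncomputable def nodeMean (b N : ℕ) {s₁ s₂ : ℕ} (P : ℕ → (Fin s₁ → ℝ) × (Fin s₂ → ℝ))
    (kl : (Fin s₁ → ℕ) × (Fin s₂ → ℤ)) : ℂ :=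
  (1 / (N : ℂ)) * ∑ n ∈ Finset.range N, basisFun b kl (P n)

/-- The weighted sum of the squared means of all basis functions over the nodes. -/
noncomputable def meanSqSum (b : ℕ) (α₁ α₂ : ℝ) (γ₁ γ₂ : ℕ → ℝ) {s₁ s₂ : ℕ} (N : ℕ)
    (P : ℕ → (Fin s₁ → ℝ) × (Fin s₂ → ℝ)) : ℝ≥0∞ :=
  ∑' kl, ENNReal.ofReal (weight b α₁ α₂ γ₁ γ₂ kl) * ENNReal.ofReal (‖nodeMean b N P kl‖ ^ 2)

section Error

variable {b : ℕ} {α₁ α₂ : ℝ} {γ₁ γ₂ : ℕ → ℝ} {s₁ s₂ : ℕ}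

lemma rWal_pos (hb : 0 < b) (α : ℝ) {γ : ℝ} (hγ : 0 < γ) (k : ℕ) : 0 < rWal b α γ k := by
  unfold rWal
  split_ifs <;> positivity

lemma rKor_pos (α : ℝ) {γ : ℝ} (hγ : 0 < γ) (l : ℤ) : 0 < rKor α γ l := by
  unfold rKor
  split_ifs with h
  · positivity
  · have : (l : ℝ) ≠ 0 := by exact_mod_cast h
    positivity

lemma weight_pos (hb : 0 < b) (hγ₁ : ∀ j, 0 < γ₁ j) (hγ₂ : ∀ j, 0 < γ₂ j)
    (kl : (Fin s₁ → ℕ) × (Fin s₂ → ℤ)) : 0 < weight b α₁ α₂ γ₁ γ₂ kl :=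
  mul_pos (Finset.prod_pos fun j _ => rWal_pos hb _ (hγ₁ j) _)
    (Finset.prod_pos fun j _ => rKor_pos _ (hγ₂ j) _)

lemma weight_zero : weight b α₁ α₂ γ₁ γ₂ (0 : (Fin s₁ → ℕ) × (Fin s₂ → ℤ)) = 1 := by
  simp [weight, rWalVec, rKorVec, rWal, rKor]

lemma normSummand_eq (f : (Fin s₁ → ℝ) × (Fin s₂ → ℝ) → ℂ) (kl : (Fin s₁ → ℕ) × (Fin s₂ → ℤ)) :
    normSummand b α₁ α₂ γ₁ γ₂ f kl = (weight b α₁ α₂ γ₁ γ₂ kl)⁻¹ * ‖coeff b f kl‖ ^ 2 := by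
  rw [normSummand, weight, mul_inv]

/-- The error of the quasi-Monte Carlo rule on the basis function `wal_k e_l`. -/
noncomputable def basisError (b N : ℕ) (P : ℕ → (Fin s₁ → ℝ) × (Fin s₂ → ℝ))
    (kl : (Fin s₁ → ℕ) × (Fin s₂ → ℤ)) : ℂ :=
  (if kl = 0 then 1 else 0) - nodeMean b N P kl

lemma hasSum_error {N : ℕ} {P : ℕ → (Fin s₁ → ℝ) × (Fin s₂ → ℝ)}
    (hP : ∀ n, P n ∈ cube s₁ s₂) {f : (Fin s₁ → ℝ) × (Fin s₂ → ℝ) → ℂ}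
    (hf : ∀ p ∈ cube s₁ s₂, HasSum (fun kl => coeff b f kl * basisFun b kl p) (f p)) :
    HasSum (fun kl => coeff b f kl * basisError b N P kl)
      ((∫ p in cube s₁ s₂, f p) - (1 / (N : ℂ)) * ∑ n ∈ Finset.range N, f (P n)) := by
  have h1 : HasSum (fun kl => (1 / (N : ℂ)) * ∑ n ∈ Finset.range N,
      coeff b f kl * basisFun b kl (P n)) ((1 / (N : ℂ)) * ∑ n ∈ Finset.range N, f (P n)) :=
    (hasSum_sum fun n _ => hf _ (hP n)).mul_left _
  have h2 : HasSum (fun kl : (Fin s₁ → ℕ) × (Fin s₂ → ℤ) => if kl = 0 then coeff b f 0 else 0) (coeff b f 0) :=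
    hasSum_ite_eq 0 _
  rw [coeff_zero] at h2
  refine (h2.sub h1).congr_fun fun kl => ?_
  rw [basisError, nodeMean, mul_sub, ← Finset.mul_sum]
  congr 1
  · split_ifs with h <;> simp [h, coeff_zero]
  · ring

lemma norm_sum_sq_le {ι : Type*} (s : Finset ι) (w : ι → ℝ) (hw : ∀ i, 0 < w i) (c e : ι → ℂ) :
    ‖∑ i ∈ s, c i * e i‖ ^ 2 ≤ (∑ i ∈ s, (w i)⁻¹ * ‖c i‖ ^ 2) * ∑ i ∈ s, w i * ‖e i‖ ^ 2 := by
  have h1 : ‖∑ i ∈ s, c i * e i‖ ≤ ∑ i ∈ s, ((√(w i))⁻¹ * ‖c i‖) * (√(w i) * ‖e i‖) := by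
    refine (norm_sum_le _ _).trans (Finset.sum_le_sum fun i _ => ?_)
    have : √(w i) ≠ 0 := (Real.sqrt_pos.2 (hw i)).ne'
    rw [norm_mul]
    field_simp
    rfl
  refine (pow_le_pow_left₀ (norm_nonneg _) h1 2).trans
    ((Finset.sum_mul_sq_le_sq_mul_sq _ _ _).trans_eq ?_)
  simp only [mul_pow, inv_pow, Real.sq_sqrt (hw _).le]

lemma enorm_sq_eq_ofReal (z : ℂ) : ‖z‖ₑ ^ 2 = ENNReal.ofReal (‖z‖ ^ 2) := by
  rw [← ofReal_norm, ENNReal.ofReal_pow (norm_nonneg _)]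

/-- Cauchy–Schwarz is applied to finite partial sums of the error series and the limit is taken
afterwards, so the right side may be infinite. -/
lemma worstCaseError_sq_le (hb : 0 < b) (hγ₁ : ∀ j, 0 < γ₁ j) (hγ₂ : ∀ j, 0 < γ₂ j)
    {N : ℕ} {P : ℕ → (Fin s₁ → ℝ) × (Fin s₂ → ℝ)} (hP : ∀ n, P n ∈ cube s₁ s₂) :
    worstCaseError b α₁ α₂ γ₁ γ₂ N P ^ 2 ≤ ∑' kl : (Fin s₁ → ℕ) × (Fin s₂ → ℤ),
      ENNReal.ofReal (weight b α₁ α₂ γ₁ γ₂ kl * ‖basisError b N P kl‖ ^ 2) := by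
  have hw := weight_pos (s₁ := s₁) (s₂ := s₂) (α₁ := α₁) (α₂ := α₂) hb hγ₁ hγ₂
  -- The square is moved to the other side as a root, so that the supremum can be bounded function
  -- by function.
  rw [← ENNReal.rpow_natCast, ← ENNReal.le_rpow_inv_iff (by norm_num)]
  refine iSup_le fun f => iSup_le fun hf => iSup_le fun hnorm => ?_
  rw [ENNReal.le_rpow_inv_iff (by norm_num), ENNReal.rpow_natCast]
  have hsum := hasSum_error (N := N) hP hf.hasSum
  have htends := (((ENNReal.continuous_pow 2).comp (continuous_enorm (E := ℂ))).tendsto _).comp hsum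
  refine le_of_tendsto' htends fun s => ?_
  have h1 : ∑ kl ∈ s, (weight b α₁ α₂ γ₁ γ₂ kl)⁻¹ * ‖coeff b f kl‖ ^ 2 ≤ 1 := by
    simp only [← normSummand_eq]
    refine (hf.summable.sum_le_tsum s fun kl _ => ?_).trans (Real.sqrt_le_one.1 hnorm)
    rw [normSummand_eq]
    have := hw kl
    positivity
  have h0 : ∀ kl, 0 ≤ weight b α₁ α₂ γ₁ γ₂ kl * ‖basisError b N P kl‖ ^ 2 := fun kl => by
    have := hw kl
    positivity
  calc ‖∑ kl ∈ s, coeff b f kl * basisError b N P kl‖ₑ ^ 2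
      ≤ ENNReal.ofReal (∑ kl ∈ s, weight b α₁ α₂ γ₁ γ₂ kl * ‖basisError b N P kl‖ ^ 2) := by
        rw [enorm_sq_eq_ofReal]
        refine ENNReal.ofReal_le_ofReal ((norm_sum_sq_le s _ hw _ _).trans ?_)
        exact mul_le_of_le_one_left (Finset.sum_nonneg fun kl _ => h0 kl) h1
    _ ≤ _ := by
        rw [ENNReal.ofReal_sum_of_nonneg fun kl _ => h0 kl]
        exact ENNReal.sum_le_tsum s

/-- For each finite index set the equality case of Cauchy–Schwarz is an explicit member of the unit
ball; the supremum over finite sets gives the whole sum. -/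
lemma le_worstCaseError_sq (hb : 1 < b) (hγ₁ : ∀ j, 0 < γ₁ j) (hγ₂ : ∀ j, 0 < γ₂ j)
    {N : ℕ} {P : ℕ → (Fin s₁ → ℝ) × (Fin s₂ → ℝ)} (hP : ∀ n, P n ∈ cube s₁ s₂) :
    ∑' kl : (Fin s₁ → ℕ) × (Fin s₂ → ℤ),
      ENNReal.ofReal (weight b α₁ α₂ γ₁ γ₂ kl * ‖basisError b N P kl‖ ^ 2) ≤
    worstCaseError b α₁ α₂ γ₁ γ₂ N P ^ 2 := by
  have hw := weight_pos (s₁ := s₁) (s₂ := s₂) (α₁ := α₁) (α₂ := α₂) (by omega : 0 < b) hγ₁ hγ₂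
  rw [ENNReal.tsum_eq_iSup_sum]
  refine iSup_le fun s => ?_
  set E := basisError b N P with hE
  have h0 : ∀ kl, 0 ≤ weight b α₁ α₂ γ₁ γ₂ kl * ‖E kl‖ ^ 2 := fun kl => by
    have := hw kl
    positivity
  rw [← ENNReal.ofReal_sum_of_nonneg fun kl _ => h0 kl]
  set S := ∑ kl ∈ s, weight b α₁ α₂ γ₁ γ₂ kl * ‖E kl‖ ^ 2 with hS
  rcases (Finset.sum_nonneg fun kl (_ : kl ∈ s) => h0 kl).eq_or_lt with hS0 | hS0
  · rw [← hS] at hS0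
    simp [← hS0]
  rw [← hS] at hS0
  have hsq : √S ≠ 0 := (Real.sqrt_pos.2 hS0).ne'
  -- The Riesz representer of the error on these indices, `w · conj E`, divided by its norm `√S`;
  -- the function then has norm `1` and error `√S`.
  set a : (Fin s₁ → ℕ) × (Fin s₂ → ℤ) → ℂ := fun kl =>
    ((weight b α₁ α₂ γ₁ γ₂ kl / √S : ℝ) : ℂ) * (starRingEnd ℂ) (E kl) with ha
  set F : (Fin s₁ → ℝ) × (Fin s₂ → ℝ) → ℂ := fun p => ∑ i ∈ s, a i * basisFun b i p with hF
  have hcoeff : ∀ kl, coeff b F kl = if kl ∈ s then a kl else 0 := coeff_sum_basisFun hb s a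
  have hsumF : ∀ p ∈ cube s₁ s₂, HasSum (fun kl => coeff b F kl * basisFun b kl p) (F p) := by
    intro p _
    have : F p = ∑ kl ∈ s, coeff b F kl * basisFun b kl p :=
      Finset.sum_congr rfl fun kl hkl => by rw [hcoeff, if_pos hkl]
    rw [this]
    exact hasSum_sum_of_ne_finset_zero fun kl hkl => by rw [hcoeff, if_neg hkl, zero_mul]
  have hnormsum : HasSum (normSummand b α₁ α₂ γ₁ γ₂ F) 1 := by
    have : (1 : ℝ) = ∑ kl ∈ s, normSummand b α₁ α₂ γ₁ γ₂ F kl := by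
      have h1 : ∀ kl ∈ s, normSummand b α₁ α₂ γ₁ γ₂ F kl =
          (weight b α₁ α₂ γ₁ γ₂ kl * ‖E kl‖ ^ 2) / S := by
        intro kl hkl
        have := (hw kl).ne'
        rw [normSummand_eq, hcoeff, if_pos hkl, ha]
        simp only [norm_mul, RCLike.norm_conj, Complex.norm_real, Real.norm_eq_abs]
        rw [mul_pow, sq_abs, div_pow, Real.sq_sqrt hS0.le]
        field_simp
      rw [Finset.sum_congr rfl h1, ← Finset.sum_div, div_self hS0.ne']
    rw [this]
    refine hasSum_sum_of_ne_finset_zero fun kl hkl => ?_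
    rw [normSummand_eq, hcoeff, if_neg hkl]
    simp
  have hmem : MemHybrid b α₁ α₂ γ₁ γ₂ F := by
    refine ⟨?_, hsumF, hnormsum.summable⟩
    exact integrable_finsetSum _ fun i _ => (integrableOn_basisFun b i).const_mul _
  have herr : (∫ p in cube s₁ s₂, F p) - (1 / (N : ℂ)) * ∑ n ∈ Finset.range N, F (P n) =
      ((√S : ℝ) : ℂ) := by
    refine (hasSum_error hP hsumF).unique ?_
    have : ((√S : ℝ) : ℂ) = ∑ kl ∈ s, coeff b F kl * E kl := by
      have h1 : ∀ kl ∈ s, coeff b F kl * E kl =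
          ((weight b α₁ α₂ γ₁ γ₂ kl * ‖E kl‖ ^ 2 : ℝ) : ℂ) / ((√S : ℝ) : ℂ) := by
        intro kl hkl
        rw [hcoeff, if_pos hkl, ha]
        simp only
        rw [mul_assoc, Complex.conj_mul']
        push_cast
        ring
      rw [Finset.sum_congr rfl h1, ← Finset.sum_div, ← Complex.ofReal_sum, ← hS,
        ← Complex.ofReal_div, Real.div_sqrt]
    rw [this]
    exact hasSum_sum_of_ne_finset_zero fun kl hkl => by rw [hcoeff, if_neg hkl, zero_mul]
  have hle : ‖((√S : ℝ) : ℂ)‖ₑ ≤ worstCaseError b α₁ α₂ γ₁ γ₂ N P := by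
    rw [← herr]
    refine le_iSup_of_le F (le_iSup_of_le hmem (le_iSup_of_le ?_ le_rfl))
    rw [hybridNorm, hnormsum.tsum_eq, Real.sqrt_one]
  refine le_trans (le_of_eq ?_) (pow_le_pow_left' hle 2)
  rw [enorm_sq_eq_ofReal, Complex.norm_real, Real.norm_eq_abs, sq_abs, Real.sq_sqrt hS0.le]

lemma nodeMean_zero {N : ℕ} (hN : 0 < N) (P : ℕ → (Fin s₁ → ℝ) × (Fin s₂ → ℝ)) :
    nodeMean b N P 0 = 1 := by
  have : (N : ℂ) ≠ 0 := by exact_mod_cast hN.ne'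
  simp [nodeMean, basisFun_zero, this]

/-- The zero index contributes nothing to the error but exactly `1` to the mean-square sum; at all
other indices the two summands agree. Adding `1` avoids truncated subtraction. -/
lemma worstCaseError_sq_add_one (hb : 1 < b) (hγ₁ : ∀ j, 0 < γ₁ j) (hγ₂ : ∀ j, 0 < γ₂ j)
    {N : ℕ} (hN : 0 < N) {P : ℕ → (Fin s₁ → ℝ) × (Fin s₂ → ℝ)} (hP : ∀ n, P n ∈ cube s₁ s₂) :
    worstCaseError b α₁ α₂ γ₁ γ₂ N P ^ 2 + 1 = meanSqSum b α₁ α₂ γ₁ γ₂ N P := by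
  have hw := weight_pos (s₁ := s₁) (s₂ := s₂) (α₁ := α₁) (α₂ := α₂) (by omega : 0 < b) hγ₁ hγ₂
  rw [le_antisymm (worstCaseError_sq_le (by omega) hγ₁ hγ₂ hP)
    (le_worstCaseError_sq hb hγ₁ hγ₂ hP)]
  have h1 : (1 : ℝ≥0∞) = ∑' kl : (Fin s₁ → ℕ) × (Fin s₂ → ℤ), if kl = 0 then 1 else 0 := by
    rw [tsum_ite_eq]
  rw [h1, ← ENNReal.tsum_add, meanSqSum]
  refine tsum_congr fun kl => ?_
  rw [← ENNReal.ofReal_mul (hw kl).le, basisError]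
  by_cases h : kl = 0
  · subst h
    simp [nodeMean_zero hN, weight_zero]
  · simp [h]

end Error

/-! ### Polynomial lattices -/

lemma sum_norm_sq_of_orthogonal {ι : Type*} (Γ : Finset ι) {N : ℕ} (hN : 0 < N) {φ : ℕ → ℂ}
    {χ : ι → ℕ → ℂ} (hφ : ∀ n, ‖φ n‖ = 1) (hχ : ∀ g n, ‖χ g n‖ = 1)
    (horth : ∀ n < N, ∀ n' < N, n ≠ n' → ∑ g ∈ Γ, χ g n * (starRingEnd ℂ) (χ g n') = 0) :
    ∑ g ∈ Γ, ‖(1 / (N : ℂ)) * ∑ n ∈ Finset.range N, φ n * χ g n‖ ^ 2 = Γ.card / N := by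
  have hN' : (N : ℂ) ≠ 0 := by exact_mod_cast hN.ne'
  apply Complex.ofReal_injective
  push_cast
  have hterm : ∀ g ∈ Γ, ((‖(1 / (N : ℂ)) * ∑ n ∈ Finset.range N, φ n * χ g n‖ : ℝ) : ℂ) ^ 2 =
      ∑ n ∈ Finset.range N, ∑ n' ∈ Finset.range N, (1 / (N : ℂ)) ^ 2 *
        (φ n * (starRingEnd ℂ) (φ n')) * (χ g n * (starRingEnd ℂ) (χ g n')) := by
    intro g _
    rw [← Complex.mul_conj', map_mul, map_sum, mul_mul_mul_comm, Finset.sum_mul_sum,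
      Finset.mul_sum]
    refine Finset.sum_congr rfl fun n _ => ?_
    rw [Finset.mul_sum]
    refine Finset.sum_congr rfl fun n' _ => ?_
    simp only [map_mul, map_div₀, map_one, map_natCast]
    ring
  rw [Finset.sum_congr rfl hterm, Finset.sum_comm]
  have hinner : ∀ n ∈ Finset.range N, ∑ g ∈ Γ, ∑ n' ∈ Finset.range N, (1 / (N : ℂ)) ^ 2 *
        (φ n * (starRingEnd ℂ) (φ n')) * (χ g n * (starRingEnd ℂ) (χ g n')) =
      (1 / (N : ℂ)) ^ 2 * Γ.card := by
    intro n hn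
    -- Orthogonality leaves only the diagonal `n' = n`, where every factor is unimodular.
    rw [Finset.sum_comm, Finset.sum_eq_single n]
    · simp [Complex.mul_conj', hφ, hχ]
      ring
    · intro n' hn' hne
      rw [← Finset.mul_sum, horth n (Finset.mem_range.1 hn) n' (Finset.mem_range.1 hn') hne.symm,
        mul_zero]
    · intro h
      exact absurd hn h
  rw [Finset.sum_congr rfl hinner]
  simp
  field_simp

/-- The number with digits `t 0, …, t (m - 1)` after the point, and zeros from there on. -/
noncomputable def ofFracDigits (b m : ℕ) (t : ℕ → ℕ) : ℝ :=
  ∑ i ∈ Finset.range m, (t i : ℝ) * ((b : ℝ) ^ (i + 1))⁻¹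

lemma ofFracDigits_succ (b m : ℕ) (t : ℕ → ℕ) :
    ofFracDigits b (m + 1) t = (t 0 + ofFracDigits b m fun i => t (i + 1)) / b := by
  rw [ofFracDigits, Finset.sum_range_succ', ofFracDigits, add_div, Finset.sum_div, add_comm]
  congr 1
  · simp [div_eq_mul_inv]
  · refine Finset.sum_congr rfl fun i _ => ?_
    rw [pow_succ _ (i + 1), mul_inv, div_eq_mul_inv, mul_assoc]

lemma ofFracDigits_mem {b : ℕ} (m : ℕ) {t : ℕ → ℕ} (ht : ∀ i, t i < b) :
    ofFracDigits b m t ∈ Set.Ico (0 : ℝ) 1 := by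
  induction m generalizing t with
  | zero => simp [ofFracDigits]
  | succ m ih =>
    obtain ⟨h0, h1⟩ := ih (t := fun i => t (i + 1)) fun i => ht _
    have hb : (0 : ℝ) < b := by
      have := ht 0
      exact_mod_cast (by omega : 0 < b)
    have h2 : (t 0 : ℝ) + 1 ≤ b := by exact_mod_cast ht 0
    rw [ofFracDigits_succ]
    exact ⟨by positivity, by rw [div_lt_one hb]; linarith⟩

lemma wal_ofFracDigits {b : ℕ} (hb : 1 < b) (m k : ℕ) {t : ℕ → ℕ} (ht : ∀ i, t i < b) :
    wal b k (ofFracDigits b m t) =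
      ee ((∑ i ∈ Finset.range m, (t i * natDigit b k i : ℝ)) / b) := by
  induction m generalizing t k with
  | zero => simp [ofFracDigits, wal, realDigit]
  | succ m ih =>
    rw [ofFracDigits_succ, wal_add_div hb (ht 0) k (ofFracDigits_mem m fun i => ht (i + 1)),
      ih (k / b) fun i => ht (i + 1), ← ee_add, Finset.sum_range_succ', ← add_div, add_comm]
    congr 2
    simp only [natDigit, pow_zero, Nat.div_one, pow_succ', Nat.div_div_eq_div_mul]

lemma pow_dvd_of_natDigit_eq_zero {b m k : ℕ} (h : ∀ i < m, natDigit b k i = 0) : b ^ m ∣ k := by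
  induction m with
  | zero => simp
  | succ m ih =>
    rw [Nat.dvd_iff_mod_eq_zero, Nat.mod_pow_succ,
      Nat.mod_eq_zero_of_dvd (ih fun i hi => h i (by omega))]
    have := h m (by omega)
    rw [natDigit] at this
    simp [this]

lemma mod_pow_eq_of_natDigit_eq {b m n n' : ℕ} (h : ∀ i < m, natDigit b n i = natDigit b n' i) :
    n % b ^ m = n' % b ^ m := by
  induction m with
  | zero => simp [Nat.mod_one]
  | succ m ih =>
    have := h m (by omega)
    rw [natDigit, natDigit] at this
    rw [Nat.mod_pow_succ, Nat.mod_pow_succ, ih fun i hi => h i (by omega), this]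

/-! ### Walsh functions at polynomial lattice points as characters of `𝔽_b[x]` -/

section Laurent

variable {b : ℕ} [Fact b.Prime]

lemma one_lt_of_fact : 1 < b := (Fact.out : b.Prime).one_lt

lemma nu_eq (m : ℕ) (L : LaurentSeries (ZMod b)) :
    nu b m L = ofFracDigits b m fun i => (L.coeff ((i : ℤ) + 1)).val := by
  have h := Finset.sum_Ico_add' (fun l : ℕ => ((L.coeff (l : ℤ)).val : ℝ) * ((b : ℝ) ^ l)⁻¹) 0 m 1
  rw [nu, ofFracDigits, Finset.range_eq_Ico]
  simp only [Nat.cast_add, Nat.cast_one, zero_add] at h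
  exact h.symm

/-- The `ZMod b`-valued pairing of the digits of `k` with the first `m` digits of `L`. -/
noncomputable def digitPairing (m k : ℕ) : LaurentSeries (ZMod b) →+ ZMod b where
  toFun L := ∑ i ∈ Finset.range m, L.coeff ((i : ℤ) + 1) * (natDigit b k i : ZMod b)
  map_zero' := by simp
  map_add' L L' := by simp [add_mul, Finset.sum_add_distrib]

lemma stdAddChar_natCast (n : ℕ) : ZMod.stdAddChar (n : ZMod b) = ee ((n : ℝ) / b) := by
  have := ZMod.stdAddChar_coe (N := b) (n : ℤ)
  rw [Int.cast_natCast] at this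
  rw [this, ee]
  congr 1
  push_cast
  ring

lemma wal_nu (m k : ℕ) (L : LaurentSeries (ZMod b)) :
    wal b k (nu b m L) = ZMod.stdAddChar (digitPairing m k L) := by
  rw [nu_eq, wal_ofFracDigits one_lt_of_fact m k fun i => ZMod.val_lt _]
  have : digitPairing m k L = ((∑ i ∈ Finset.range m,
      (L.coeff ((i : ℤ) + 1)).val * natDigit b k i : ℕ) : ZMod b) := by
    simp [digitPairing]
  rw [this, stdAddChar_natCast]
  push_cast
  rfl

lemma toLaurent_eq_sum (q : (ZMod b)[X]) :
    toLaurent b q = ∑ n ∈ Finset.range (q.natDegree + 1),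
      HahnSeries.single (-(n : ℤ)) (q.coeff n) := by
  rw [toLaurent, Polynomial.coe_eval₂RingHom, Polynomial.eval₂_eq_sum_range]
  refine Finset.sum_congr rfl fun n _ => ?_
  rw [HahnSeries.single_pow, HahnSeries.C_apply, HahnSeries.single_mul_single]
  simp

lemma coeff_toLaurent_neg (q : (ZMod b)[X]) (j : ℕ) :
    (toLaurent b q).coeff (-(j : ℤ)) = q.coeff j := by
  rw [toLaurent_eq_sum, HahnSeries.coeff_sum]
  simp only [HahnSeries.coeff_single, neg_inj, Nat.cast_inj]
  rw [Finset.sum_ite_eq]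
  split_ifs with h
  · rfl
  · rw [Polynomial.coeff_eq_zero_of_natDegree_lt]
    simpa using h

lemma coeff_toLaurent_pos (q : (ZMod b)[X]) {i : ℤ} (hi : 0 < i) :
    (toLaurent b q).coeff i = 0 := by
  rw [toLaurent_eq_sum, HahnSeries.coeff_sum]
  refine Finset.sum_eq_zero fun n _ => ?_
  rw [HahnSeries.coeff_single_of_ne]
  omega

lemma toLaurent_ne_zero {q : (ZMod b)[X]} (hq : q ≠ 0) : toLaurent b q ≠ 0 := by
  intro h
  have := coeff_toLaurent_neg q q.natDegree
  rw [h] at this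
  exact hq (Polynomial.leadingCoeff_eq_zero.1 this.symm)

/-- With `T = x⁻¹`, the lowest power of `T` is the highest power of `x`. -/
lemma order_toLaurent {q : (ZMod b)[X]} (hq : q ≠ 0) :
    (toLaurent b q).order = -(q.natDegree : ℤ) := by
  apply le_antisymm
  · apply HahnSeries.order_le_of_coeff_ne_zero
    rw [coeff_toLaurent_neg]
    simpa using hq
  · by_contra! h
    have h1 := HahnSeries.coeff_order_eq_zero.not.2 (toLaurent_ne_zero hq)
    obtain ⟨j, hj⟩ : ∃ j : ℕ, (toLaurent b q).order = -(j : ℤ) :=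
      ⟨(-(toLaurent b q).order).toNat, by omega⟩
    rw [hj, coeff_toLaurent_neg] at h1
    exact h1 (Polynomial.coeff_eq_zero_of_natDegree_lt (by omega))

/-- The additive character `h ↦ wal_k(ν_m(h / f))` of the polynomial ring. -/
noncomputable def walChar (m k : ℕ) (f : (ZMod b)[X]) : AddChar (ZMod b)[X] ℂ :=
  ZMod.stdAddChar.compAddMonoidHom ((digitPairing m k).comp
    ((AddMonoidHom.mulRight (toLaurent b f)⁻¹).comp (toLaurent b).toAddMonoidHom))

lemma walChar_apply (m k : ℕ) (f h : (ZMod b)[X]) :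
    walChar m k f h = ZMod.stdAddChar (digitPairing m k (toLaurent b h / toLaurent b f)) := by
  rw [div_eq_mul_inv]
  rfl

lemma wal_polyLatticePoint (m k : ℕ) (f : (ZMod b)[X]) {s : ℕ} (g : Fin s → (ZMod b)[X]) (n : ℕ)
    (j : Fin s) :
    wal b k (polyLatticePoint b m f g n j) = walChar m k f (natPoly b m n * g j) := by
  rw [polyLatticePoint, wal_nu, walChar_apply]

/-- A polynomial has no fractional digits, so the character factors through `𝔽_b[x]/(f)`. -/
lemma walChar_mul_left_self (m k : ℕ) {f : (ZMod b)[X]} (hf : f ≠ 0) (q : (ZMod b)[X]) :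
    walChar m k f (f * q) = 1 := by
  rw [walChar_apply, map_mul, mul_div_cancel_left₀ _ (toLaurent_ne_zero hf)]
  have : digitPairing m k (toLaurent b q) = 0 := by
    change ∑ i ∈ Finset.range m, _ = _
    refine Finset.sum_eq_zero fun i _ => ?_
    rw [coeff_toLaurent_pos _ (by omega), zero_mul]
  rw [this, AddChar.map_zero_eq_one]

lemma natCast_natDigit_ne_zero {k i : ℕ} (h : natDigit b k i ≠ 0) :
    (natDigit b k i : ZMod b) ≠ 0 := by
  rw [Ne, ZMod.natCast_eq_zero_iff]
  exact Nat.not_dvd_of_pos_of_lt (Nat.pos_of_ne_zero h)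
    (Nat.mod_lt _ (Fact.out : b.Prime).pos)

lemma exists_walChar_ne_one {m k : ℕ} {f : (ZMod b)[X]} (hf : f ≠ 0) (hdeg : f.natDegree = m)
    (hk : ¬ b ^ m ∣ k) : ∃ h : (ZMod b)[X], walChar m k f h ≠ 1 := by
  have hex : ((Finset.range m).filter fun i => natDigit b k i ≠ 0).Nonempty := by
    by_contra hcon
    rw [Finset.not_nonempty_iff_eq_empty, Finset.filter_eq_empty_iff] at hcon
    exact hk (pow_dvd_of_natDigit_eq_zero fun i hi => by simpa using hcon (Finset.mem_range.2 hi))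
  set i₀ := Finset.max' _ hex with hi₀
  obtain ⟨hi₀m, hi₀d⟩ : i₀ < m ∧ natDigit b k i₀ ≠ 0 := by
    have := Finset.max'_mem _ hex
    rw [← hi₀, Finset.mem_filter, Finset.mem_range] at this
    exact this
  have hmax : ∀ i < m, i₀ < i → natDigit b k i = 0 := by
    intro i hi hlt
    by_contra hne
    have := Finset.le_max' ((Finset.range m).filter fun i => natDigit b k i ≠ 0) i (by simp [hi, hne])
    omega
  -- The exponent makes the first nonzero digit of `h / f` fall at index `i₀`, the last nonzero
  -- digit of `k` among the first `m`; the pairing then has a single nonzero term.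
  set h : (ZMod b)[X] := Polynomial.X ^ (m - 1 - i₀) with hh
  have hX : h ≠ 0 := pow_ne_zero _ Polynomial.X_ne_zero
  set G := toLaurent b h / toLaurent b f with hG
  have hF := toLaurent_ne_zero hf
  have hG0 : G ≠ 0 := div_ne_zero (toLaurent_ne_zero hX) hF
  have hord : G.order = (i₀ : ℤ) + 1 := by
    have h1 : G * toLaurent b f = toLaurent b h := div_mul_cancel₀ _ hF
    have h2 := HahnSeries.order_mul hG0 hF
    rw [h1, order_toLaurent hX, order_toLaurent hf, hdeg, hh, Polynomial.natDegree_X_pow] at h2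
    omega
  refine ⟨h, ?_⟩
  rw [walChar_apply, ← hG]
  have hpair : digitPairing m k G = G.coeff ((i₀ : ℤ) + 1) * (natDigit b k i₀ : ZMod b) := by
    change ∑ i ∈ Finset.range m, G.coeff ((i : ℤ) + 1) * (natDigit b k i : ZMod b) = _
    refine Finset.sum_eq_single i₀ (fun i hi hne => ?_) fun hcon => ?_
    · rcases lt_or_gt_of_ne hne with hlt | hlt
      · rw [HahnSeries.coeff_eq_zero_of_lt_order (by omega), zero_mul]
      · rw [hmax i (Finset.mem_range.1 hi) hlt, Nat.cast_zero, mul_zero]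
    · exact absurd (Finset.mem_range.2 hi₀m) hcon
  have hne : digitPairing m k G ≠ 0 := by
    rw [hpair, ← hord]
    refine mul_ne_zero ?_ (natCast_natDigit_ne_zero hi₀d)
    exact HahnSeries.coeff_order_eq_zero.not.2 hG0
  intro hcon
  rw [← AddChar.map_zero_eq_one (ZMod.stdAddChar (N := b))] at hcon
  exact hne (ZMod.injective_stdAddChar hcon)

noncomputable instance (m : ℕ) : Fintype (Polynomial.degreeLT (ZMod b) m) :=
  Fintype.ofEquiv _ (Polynomial.degreeLTEquiv (ZMod b) m).toEquiv.symm

lemma card_degreeLT (m : ℕ) : Fintype.card (Polynomial.degreeLT (ZMod b) m) = b ^ m := by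
  rw [Fintype.card_congr (Polynomial.degreeLTEquiv (ZMod b) m).toEquiv]
  simp

/-- Since `p` is invertible modulo the irreducible `f`, some translation of `g` shifts `p * g` by
`h` modulo `f`, where the character at `h` is not `1`. The sum is invariant under the translation
and is multiplied by that value, so it vanishes. -/
lemma sum_walChar_mul {m k : ℕ} {f : (ZMod b)[X]} (hf : Irreducible f) (hdeg : f.natDegree = m)
    (hk : ¬ b ^ m ∣ k) {p : (ZMod b)[X]} (hp : p ≠ 0) (hpm : p.degree < m) :
    ∑ g : Polynomial.degreeLT (ZMod b) m, walChar m k f (p * g) = 0 := by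
  obtain ⟨h, hh⟩ := exists_walChar_ne_one hf.ne_zero hdeg hk
  have hfdeg : f.degree = m := by rw [Polynomial.degree_eq_natDegree hf.ne_zero, hdeg]
  have hcop : IsCoprime p f := by
    refine (hf.coprime_iff_not_dvd.2 fun hdvd => ?_).symm
    exact absurd (Polynomial.degree_le_of_dvd hdvd hp) (by rw [hfdeg]; exact hpm.not_ge)
  obtain ⟨u, v, huv⟩ := hcop
  have hmem : (u * h) % f ∈ Polynomial.degreeLT (ZMod b) m := by
    rw [Polynomial.mem_degreeLT, ← hfdeg]
    exact EuclideanDomain.mod_lt _ hf.ne_zero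
  have htrans : walChar m k f (p * ((u * h) % f)) *
      ∑ g : Polynomial.degreeLT (ZMod b) m, walChar m k f (p * g) =
      ∑ g : Polynomial.degreeLT (ZMod b) m, walChar m k f (p * g) := by
    rw [Finset.mul_sum, ← Equiv.sum_comp
      (Equiv.addLeft (⟨_, hmem⟩ : Polynomial.degreeLT (ZMod b) m)) (fun g : Polynomial.degreeLT (ZMod b) m => walChar m k f (p * g))]
    refine Finset.sum_congr rfl fun g _ => ?_
    rw [← AddChar.map_add_eq_mul, ← mul_add]
    rfl
  by_contra hsum
  refine hh ?_
  have h1 : walChar m k f (p * ((u * h) % f)) = 1 := (mul_eq_right₀ hsum).1 htrans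
  -- Bézout `u p + v f = 1` times `h`, with `u h` reduced modulo `f`.
  have h2 : h = p * ((u * h) % f) + f * (v * h + p * ((u * h) / f)) := by
    have h3 := EuclideanDomain.div_add_mod (u * h) f
    linear_combination -h * huv - p * h3
  rw [h2, AddChar.map_add_eq_mul, h1, walChar_mul_left_self _ _ hf.ne_zero, mul_one]

lemma natPoly_mem (m n : ℕ) : natPoly b m n ∈ Polynomial.degreeLT (ZMod b) m := by
  refine Submodule.sum_mem _ fun i hi => ?_
  rw [Polynomial.mem_degreeLT]
  refine (Polynomial.degree_C_mul_X_pow_le _ _).trans_lt ?_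
  exact_mod_cast Finset.mem_range.1 hi

lemma coeff_natPoly {m i : ℕ} (hi : i < m) (n : ℕ) :
    (natPoly b m n).coeff i = (natDigit b n i : ZMod b) := by
  rw [natPoly, Polynomial.finsetSum_coeff]
  simp [Polynomial.coeff_X_pow, hi]

lemma natPoly_injOn {m n n' : ℕ} (hn : n < b ^ m) (hn' : n' < b ^ m)
    (h : natPoly b m n = natPoly b m n') : n = n' := by
  rw [← Nat.mod_eq_of_lt hn, ← Nat.mod_eq_of_lt hn']
  refine mod_pow_eq_of_natDigit_eq fun i hi => ?_
  have h1 := congrArg (fun p => p.coeff i) h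
  simp only [coeff_natPoly hi] at h1
  rw [ZMod.natCast_eq_natCast_iff'] at h1
  simpa only [natDigit, Nat.mod_mod] using h1

/-- The polynomials `n(x)` run through all polynomials of degree `< m`, so this is the case `p = 1`
of `sum_walChar_mul`. -/
lemma sum_walChar_natPoly {m k : ℕ} {f : (ZMod b)[X]} (hf : Irreducible f)
    (hdeg : f.natDegree = m) (hk : ¬ b ^ m ∣ k) :
    ∑ n ∈ Finset.range (b ^ m), walChar m k f (natPoly b m n) = 0 := by
  have hbij : Function.Bijective
      fun n : Fin (b ^ m) => (⟨natPoly b m n, natPoly_mem m n⟩ : Polynomial.degreeLT (ZMod b) m) := by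
    rw [Fintype.bijective_iff_injective_and_card]
    refine ⟨fun n n' h => ?_, by rw [card_degreeLT, Fintype.card_fin]⟩
    exact Fin.ext (natPoly_injOn n.2 n'.2 (Subtype.ext_iff.1 h))
  have hm : 0 < m := hdeg ▸ hf.natDegree_pos
  have h := sum_walChar_mul hf hdeg hk one_ne_zero (by
    rw [Polynomial.degree_one]; exact_mod_cast hm)
  rw [← hbij.sum_comp] at h
  rw [Finset.sum_range]
  simpa using h

/-- The mean square over all generators of degree `< m` of a new component. -/
lemma sum_norm_sq_walChar {m k : ℕ} {f : (ZMod b)[X]} (hf : Irreducible f)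
    (hdeg : f.natDegree = m) (hk : ¬ b ^ m ∣ k) {φ : ℕ → ℂ} (hφ : ∀ n, ‖φ n‖ = 1) :
    ∑ g : Polynomial.degreeLT (ZMod b) m, ‖(1 / ((b ^ m : ℕ) : ℂ)) *
      ∑ n ∈ Finset.range (b ^ m), φ n * walChar m k f (natPoly b m n * g)‖ ^ 2 = 1 := by
  have hb : 0 < b ^ m := pow_pos (Fact.out : b.Prime).pos _
  have h1 : ∀ h, ‖walChar m k f h‖ = 1 := fun h => by
    rw [walChar_apply]
    exact AddChar.norm_apply _ _
  rw [sum_norm_sq_of_orthogonal Finset.univ hb hφ (fun g n => h1 _), Finset.card_univ,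
    card_degreeLT, div_self (by positivity)]
  intro n hn n' hn' hne
  have hp : natPoly b m n - natPoly b m n' ≠ 0 :=
    sub_ne_zero.2 fun h => hne (natPoly_injOn hn hn' h)
  have hpm := Polynomial.mem_degreeLT.1
    ((Polynomial.degreeLT (ZMod b) m).sub_mem (natPoly_mem m n) (natPoly_mem m n'))
  rw [← sum_walChar_mul hf hdeg hk hp hpm]
  refine Finset.sum_congr rfl fun g _ => ?_
  rw [sub_mul, AddChar.map_sub_eq_div, div_eq_mul_inv, Complex.inv_def, ← Complex.sq_norm, h1]
  simp

end Laurent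

/-! ### Sums of the weights -/

/-- `b^{-α ⌊log_b k⌋}` for `k ≠ 0`, and `0` for `k = 0`. -/
noncomputable def walDecay (b : ℕ) (α : ℝ) (k : ℕ) : ℝ :=
  if k = 0 then 0 else (b : ℝ) ^ (-(α * (Nat.log b k : ℝ)))

/-- `|l|^{-α}` for `l ≠ 0`, and `0` for `l = 0`. -/
noncomputable def korDecay (α : ℝ) (l : ℤ) : ℝ :=
  if l = 0 then 0 else |(l : ℝ)| ^ (-α)

lemma walDecay_nonneg (b : ℕ) (α : ℝ) (k : ℕ) : 0 ≤ walDecay b α k := by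
  unfold walDecay
  split_ifs <;> positivity

lemma korDecay_nonneg (α : ℝ) (l : ℤ) : 0 ≤ korDecay α l := by
  unfold korDecay
  split_ifs <;> positivity

lemma rWal_eq (b : ℕ) (α γ : ℝ) (k : ℕ) :
    rWal b α γ k = (if k = 0 then 1 else 0) + γ * walDecay b α k := by
  unfold rWal walDecay
  split_ifs <;> simp

lemma rKor_eq (α γ : ℝ) (l : ℤ) :
    rKor α γ l = (if l = 0 then 1 else 0) + γ * korDecay α l := by
  unfold rKor korDecay
  split_ifs <;> simp

lemma tsum_rWal_mul (b : ℕ) (α : ℝ) {γ : ℝ} (hγ : 0 ≤ γ) (F : ℕ → ℝ≥0∞) :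
    ∑' k, ENNReal.ofReal (rWal b α γ k) * F k =
      F 0 + ENNReal.ofReal γ * ∑' k, ENNReal.ofReal (walDecay b α k) * F k := by
  have h1 : F 0 = ∑' k, if k = 0 then F 0 else 0 := by rw [tsum_ite_eq]
  rw [h1, ← ENNReal.tsum_mul_left, ← ENNReal.tsum_add]
  refine tsum_congr fun k => ?_
  rw [rWal_eq, ENNReal.ofReal_add (by split_ifs <;> norm_num)
    (mul_nonneg hγ (walDecay_nonneg _ _ _)), add_mul, ENNReal.ofReal_mul hγ, mul_assoc]
  congr 1
  split_ifs with h <;> simp [h]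

lemma tsum_rKor_mul (α : ℝ) {γ : ℝ} (hγ : 0 ≤ γ) (F : ℤ → ℝ≥0∞) :
    ∑' l, ENNReal.ofReal (rKor α γ l) * F l =
      F 0 + ENNReal.ofReal γ * ∑' l, ENNReal.ofReal (korDecay α l) * F l := by
  have h1 : F 0 = ∑' l : ℤ, if l = 0 then F 0 else 0 := by rw [tsum_ite_eq]
  rw [h1, ← ENNReal.tsum_mul_left, ← ENNReal.tsum_add]
  refine tsum_congr fun k => ?_
  rw [rKor_eq, ENNReal.ofReal_add (by split_ifs <;> norm_num)
    (mul_nonneg hγ (korDecay_nonneg _ _)), add_mul, ENNReal.ofReal_mul hγ, mul_assoc]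
  congr 1
  split_ifs with h <;> simp [h]

lemma mu_eq {b : ℕ} (hb : 1 < b) {α : ℝ} (hα : 1 < α) :
    mu b α = ((b : ℝ) - 1) * (1 - (b : ℝ) ^ (1 - α))⁻¹ := by
  have hb0 : (0 : ℝ) < b := by positivity
  have hb1 : (1 : ℝ) < b := by exact_mod_cast hb
  have h1 : (b : ℝ) < (b : ℝ) ^ α := by
    simpa using Real.rpow_lt_rpow_of_exponent_lt hb1 hα
  have h2 : (b : ℝ) ^ α - b ≠ 0 := by linarith
  have h3 : (b : ℝ) ^ α ≠ 0 := (Real.rpow_pos_of_pos hb0 _).ne'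
  rw [mu, Real.rpow_sub hb0, Real.rpow_one]
  have h4 : 1 - (b : ℝ) / (b : ℝ) ^ α = ((b : ℝ) ^ α - b) / (b : ℝ) ^ α := by field_simp
  rw [h4]
  field_simp

lemma mu_nonneg {b : ℕ} (hb : 1 < b) {α : ℝ} (hα : 1 < α) : 0 ≤ mu b α := by
  have hb1 : (1 : ℝ) < b := by exact_mod_cast hb
  have := Real.rpow_lt_one_of_one_lt_of_neg hb1 (by linarith : 1 - α < 0)
  rw [mu_eq hb hα]
  have h1 : 0 < 1 - (b : ℝ) ^ (1 - α) := by linarith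
  have h2 : 0 < (b : ℝ) - 1 := by linarith
  positivity

/-- There are `(b - 1) b^a` integers with `⌊log_b k⌋ = a`, each contributing `b^{-αa}`. -/
lemma sum_range_pow_walDecay {b : ℕ} (hb : 1 < b) (α : ℝ) (K : ℕ) :
    ∑ k ∈ Finset.range (b ^ K), walDecay b α k =
      ∑ a ∈ Finset.range K, ((b : ℝ) - 1) * ((b : ℝ) ^ (1 - α)) ^ a := by
  have hb0 : (0 : ℝ) < b := by positivity
  induction K with
  | zero => simp [walDecay]
  | succ K ih =>
    have hle : b ^ K ≤ b ^ (K + 1) := Nat.pow_le_pow_right (by omega) (by omega)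
    rw [Finset.sum_range_succ, ← ih, ← Finset.sum_range_add_sum_Ico _ hle]
    congr 1
    have hterm : ∀ k ∈ Finset.Ico (b ^ K) (b ^ (K + 1)),
        walDecay b α k = (b : ℝ) ^ (-(α * (K : ℝ))) := by
      intro k hk
      rw [Finset.mem_Ico] at hk
      have hk0 : k ≠ 0 := by
        have : 0 < b ^ K := by positivity
        omega
      rw [walDecay, if_neg hk0, Nat.log_eq_of_pow_le_of_lt_pow hk.1 hk.2]
    rw [Finset.sum_congr rfl hterm, Finset.sum_const, Nat.card_Ico, nsmul_eq_mul,
      Nat.cast_sub hle, ← Real.rpow_natCast ((b : ℝ) ^ (1 - α)), ← Real.rpow_mul hb0.le,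
      show (1 - α) * (K : ℝ) = K + -(α * K) by ring, Real.rpow_add hb0, Real.rpow_natCast]
    push_cast
    ring

lemma tsum_walDecay_le {b : ℕ} (hb : 1 < b) {α : ℝ} (hα : 1 < α) :
    ∑' k, ENNReal.ofReal (walDecay b α k) ≤ ENNReal.ofReal (mu b α) := by
  have hb1 : (1 : ℝ) < b := by exact_mod_cast hb
  rw [ENNReal.tsum_eq_iSup_nat]
  refine iSup_le fun K => ?_
  rw [← ENNReal.ofReal_sum_of_nonneg fun k _ => walDecay_nonneg _ _ _]
  refine ENNReal.ofReal_le_ofReal ?_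
  calc ∑ k ∈ Finset.range K, walDecay b α k
      ≤ ∑ k ∈ Finset.range (b ^ K), walDecay b α k :=
        Finset.sum_le_sum_of_subset_of_nonneg
          (Finset.range_mono (Nat.lt_pow_self hb).le) fun k _ _ => walDecay_nonneg _ _ _
    _ ≤ mu b α := by
        rw [sum_range_pow_walDecay hb, ← Finset.mul_sum, mu_eq hb hα]
        refine mul_le_mul_of_nonneg_left ?_ (by linarith)
        have hq0 : 0 ≤ (b : ℝ) ^ (1 - α) := by positivity
        have hq1 := Real.rpow_lt_one_of_one_lt_of_neg hb1 (by linarith : 1 - α < 0)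
        rw [← tsum_geometric_of_lt_one hq0 hq1]
        exact (summable_geometric_of_lt_one hq0 hq1).sum_le_tsum _ fun i _ => by positivity

/-- Multiplying a positive `t` by `b^m` raises the logarithm by `m`, and `b^m b^{-αm} ≤ 1`. Thus the
rare indices divisible by `b^m` can absorb a factor `N`. -/
lemma walDecay_pow_mul_le {b : ℕ} (hb : 1 < b) {α : ℝ} (hα : 1 < α) (m t : ℕ) :
    (b : ℝ) ^ m * walDecay b α (b ^ m * t) ≤ walDecay b α t := by
  have hb1 : (1 : ℝ) < b := by exact_mod_cast hb
  have hb0 : (0 : ℝ) < b := by linarith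
  rcases Nat.eq_zero_or_pos t with rfl | ht
  · simp [walDecay]
  have hbm : 0 < b ^ m := by positivity
  have hlog : Nat.log b (b ^ m * t) = m + Nat.log b t := by
    refine Nat.log_eq_of_pow_le_of_lt_pow ?_ ?_
    · rw [pow_add]
      exact Nat.mul_le_mul_left _ (Nat.pow_log_le_self b ht.ne')
    · rw [add_assoc, pow_add]
      exact Nat.mul_lt_mul_of_pos_left (Nat.lt_pow_succ_log_self hb t) hbm
  rw [walDecay, walDecay, if_neg (by positivity), if_neg ht.ne', hlog, ← Real.rpow_natCast,
    ← Real.rpow_add hb0]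
  refine Real.rpow_le_rpow_of_exponent_le hb1.le ?_
  push_cast
  nlinarith [(Nat.cast_nonneg m : (0 : ℝ) ≤ m)]

lemma tsum_walDecay_dvd_le {b : ℕ} (hb : 1 < b) {α : ℝ} (hα : 1 < α) (m : ℕ) :
    ∑' k, ENNReal.ofReal (walDecay b α k) * (if b ^ m ∣ k then ((b ^ m : ℕ) : ℝ≥0∞) else 0) ≤
      ENNReal.ofReal (mu b α) := by
  have hbm : 0 < b ^ m := pow_pos (by omega) m
  have hinj : Function.Injective fun t => b ^ m * t := fun t t' h =>
    Nat.eq_of_mul_eq_mul_left hbm h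
  rw [← hinj.tsum_eq]
  · refine (ENNReal.tsum_le_tsum fun t => ?_).trans (tsum_walDecay_le hb hα)
    rw [if_pos (Dvd.intro _ rfl), ← ENNReal.ofReal_natCast,
      ← ENNReal.ofReal_mul (walDecay_nonneg _ _ _), mul_comm]
    refine ENNReal.ofReal_le_ofReal ?_
    push_cast
    exact walDecay_pow_mul_le hb hα m t
  · intro k hk
    by_contra hcon
    refine hk ?_
    dsimp only
    rw [if_neg fun ⟨t, ht⟩ => hcon ⟨t, ht.symm⟩, mul_zero]

lemma hasSum_zetaReal {α : ℝ} (hα : 1 < α) :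
    HasSum (fun n : ℕ => 1 / (n : ℝ) ^ α) (zetaReal α) := by
  have hs : Summable fun n : ℕ => 1 / (n : ℝ) ^ α := Real.summable_one_div_nat_rpow.2 hα
  have h : zetaReal α = ∑' n : ℕ, 1 / (n : ℝ) ^ α := by
    rw [zetaReal, zeta_eq_tsum_one_div_nat_cpow (by simpa using hα)]
    have h1 : ∀ n : ℕ, 1 / (n : ℂ) ^ (α : ℂ) = ((1 / (n : ℝ) ^ α : ℝ) : ℂ) := by
      intro n
      rw [Complex.ofReal_div, Complex.ofReal_cpow (Nat.cast_nonneg n)]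
      simp
    simp only [h1]
    rw [← Complex.ofReal_tsum, Complex.ofReal_re]
  rw [h]
  exact hs.hasSum

lemma zetaReal_nonneg {α : ℝ} (hα : 1 < α) : 0 ≤ zetaReal α :=
  (hasSum_zetaReal hα).nonneg fun n => by positivity

lemma korDecay_natCast {α : ℝ} (hα : 1 < α) (n : ℕ) : korDecay α n = 1 / (n : ℝ) ^ α := by
  rw [korDecay]
  split_ifs with h
  · have : n = 0 := by exact_mod_cast h
    subst this
    -- At `n = 0` the zeta summand is `1 / 0 = 0`, matching the convention for the decay.
    rw [Nat.cast_zero, Real.zero_rpow (by linarith), div_zero]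
  · rw [Int.cast_natCast, Nat.abs_cast, Real.rpow_neg (Nat.cast_nonneg n), one_div]

lemma korDecay_neg (α : ℝ) (l : ℤ) : korDecay α (-l) = korDecay α l := by
  simp [korDecay]

lemma tsum_korDecay_le {α : ℝ} (hα : 1 < α) :
    ∑' l, ENNReal.ofReal (korDecay α l) ≤ ENNReal.ofReal (2 * zetaReal α) := by
  have hz := hasSum_zetaReal hα
  have h1 : ∑' n : ℕ, ENNReal.ofReal (korDecay α n) = ENNReal.ofReal (zetaReal α) := by
    simp only [korDecay_natCast hα]
    rw [← ENNReal.ofReal_tsum_of_nonneg (fun n => by positivity) hz.summable, hz.tsum_eq]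
  have h2 : ∑' n : ℕ, ENNReal.ofReal (korDecay α (-((n : ℤ) + 1))) ≤
      ENNReal.ofReal (zetaReal α) := by
    rw [← h1]
    simp only [korDecay_neg]
    exact ENNReal.tsum_comp_le_tsum_of_injective (f := fun n : ℕ => n + 1)
      (add_left_injective 1) (fun n : ℕ => ENNReal.ofReal (korDecay α n))
  have h3 := HasSum.of_nat_of_neg_add_one (f := fun l : ℤ => ENNReal.ofReal (korDecay α l))
    ENNReal.summable.hasSum ENNReal.summable.hasSum
  rw [h3.tsum_eq, two_mul, ENNReal.ofReal_add (zetaReal_nonneg hα) (zetaReal_nonneg hα)]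
  exact add_le_add h1.le h2

lemma natCast_mul_korDecay_le {α : ℝ} (hα : 1 < α) {G : ℕ} (hG : 0 < G) (l : ℤ) :
    (G : ℝ) * korDecay α (G * l) ≤ korDecay α l := by
  rcases eq_or_ne l 0 with rfl | hl
  · simp [korDecay]
  have hG0 : (0 : ℝ) < G := by positivity
  have hG1 : (1 : ℝ) ≤ G := by exact_mod_cast hG
  have hGl : (G : ℤ) * l ≠ 0 := mul_ne_zero (by exact_mod_cast hG.ne') hl
  rw [korDecay, korDecay, if_neg hGl, if_neg hl, Int.cast_mul, abs_mul, Int.cast_natCast,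
    Nat.abs_cast, Real.mul_rpow hG0.le (abs_nonneg _), ← mul_assoc]
  refine mul_le_of_le_one_left (by positivity) ?_
  nth_rw 1 [← Real.rpow_one (G : ℝ)]
  rw [← Real.rpow_add hG0]
  exact Real.rpow_le_one_of_one_le_of_nonpos hG1 (by linarith)

lemma tsum_korDecay_dvd_le {α : ℝ} (hα : 1 < α) {G : ℕ} (hG : 0 < G) :
    ∑' l, ENNReal.ofReal (korDecay α l) * (if (G : ℤ) ∣ l then (G : ℝ≥0∞) else 0) ≤
      ENNReal.ofReal (2 * zetaReal α) := by
  have hinj : Function.Injective fun t : ℤ => (G : ℤ) * t :=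
    mul_right_injective₀ (by exact_mod_cast hG.ne')
  rw [← hinj.tsum_eq]
  · refine (ENNReal.tsum_le_tsum fun t => ?_).trans (tsum_korDecay_le hα)
    rw [if_pos (Dvd.intro _ rfl), ← ENNReal.ofReal_natCast,
      ← ENNReal.ofReal_mul (korDecay_nonneg _ _), mul_comm]
    exact ENNReal.ofReal_le_ofReal (natCast_mul_korDecay_le hα hG t)
  · intro k hk
    by_contra hcon
    refine hk ?_
    dsimp only
    rw [if_neg fun ⟨t, ht⟩ => hcon ⟨t, ht.symm⟩, mul_zero]

/-! ### Adding one component -/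

lemma tsum_snoc_left {d₁ d₂ : ℕ} (F : (Fin (d₁ + 1) → ℕ) × (Fin d₂ → ℤ) → ℝ≥0∞) :
    ∑' kl, F kl = ∑' kl : (Fin d₁ → ℕ) × (Fin d₂ → ℤ), ∑' k : ℕ,
      F (Fin.snoc (α := fun _ => ℕ) kl.1 k, kl.2) := by
  rw [← ENNReal.tsum_prod (f := fun (kl : (Fin d₁ → ℕ) × (Fin d₂ → ℤ)) (k : ℕ) =>
      F (Fin.snoc (α := fun _ => ℕ) kl.1 k, kl.2))]
  let e : ((Fin d₁ → ℕ) × (Fin d₂ → ℤ)) × ℕ ≃ (Fin (d₁ + 1) → ℕ) × (Fin d₂ → ℤ) :=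
    { toFun := fun q => (Fin.snoc (α := fun _ => ℕ) q.1.1 q.2, q.1.2)
      invFun := fun q => ((Fin.init q.1, q.2), q.1 (Fin.last _))
      left_inv := fun q => by simp
      right_inv := fun q => by simp }
  exact (e.tsum_eq F).symm

lemma tsum_snoc_right {d₁ d₂ : ℕ} (F : (Fin d₁ → ℕ) × (Fin (d₂ + 1) → ℤ) → ℝ≥0∞) :
    ∑' kl, F kl = ∑' kl : (Fin d₁ → ℕ) × (Fin d₂ → ℤ), ∑' l : ℤ,
      F (kl.1, Fin.snoc (α := fun _ => ℤ) kl.2 l) := by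
  rw [← ENNReal.tsum_prod (f := fun (kl : (Fin d₁ → ℕ) × (Fin d₂ → ℤ)) (l : ℤ) =>
      F (kl.1, Fin.snoc (α := fun _ => ℤ) kl.2 l))]
  let e : ((Fin d₁ → ℕ) × (Fin d₂ → ℤ)) × ℤ ≃ (Fin d₁ → ℕ) × (Fin (d₂ + 1) → ℤ) :=
    { toFun := fun q => (q.1.1, Fin.snoc (α := fun _ => ℤ) q.1.2 q.2)
      invFun := fun q => ((q.1, Fin.init q.2), q.2 (Fin.last _))
      left_inv := fun q => by simp
      right_inv := fun q => by simp }
  exact (e.tsum_eq F).symm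

section Weights

variable {b : ℕ} {α₁ α₂ : ℝ} {γ₁ γ₂ : ℕ → ℝ} {d₁ d₂ : ℕ}

lemma weight_snoc_left (k : Fin d₁ → ℕ) (k' : ℕ) (l : Fin d₂ → ℤ) :
    weight b α₁ α₂ γ₁ γ₂ (Fin.snoc (α := fun _ => ℕ) k k', l) =
      weight b α₁ α₂ γ₁ γ₂ (k, l) * rWal b α₁ (γ₁ d₁) k' := by
  simp only [weight, rWalVec, Fin.prod_univ_castSucc, Fin.snoc_castSucc, Fin.snoc_last,
    Fin.val_castSucc, Fin.val_last]
  ring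

lemma weight_snoc_right (k : Fin d₁ → ℕ) (l : Fin d₂ → ℤ) (l' : ℤ) :
    weight b α₁ α₂ γ₁ γ₂ (k, Fin.snoc (α := fun _ => ℤ) l l') =
      weight b α₁ α₂ γ₁ γ₂ (k, l) * rKor α₂ (γ₂ d₂) l' := by
  simp only [weight, rKorVec, Fin.prod_univ_castSucc, Fin.snoc_castSucc, Fin.snoc_last,
    Fin.val_castSucc, Fin.val_last]
  ring

/-- The upper bound `∏ (1 + 2 γ⁽¹⁾_j μ(α₁)) ∏ (1 + 4 γ⁽²⁾_j ζ(α₂))`. -/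
noncomputable def weightBound (b : ℕ) (α₁ α₂ : ℝ) (γ₁ γ₂ : ℕ → ℝ) (d₁ d₂ : ℕ) : ℝ :=
  (∏ j ∈ Finset.range d₁, (1 + 2 * γ₁ j * mu b α₁)) *
    ∏ j ∈ Finset.range d₂, (1 + 4 * γ₂ j * zetaReal α₂)

lemma weightBound_nonneg (hb : 1 < b) (hα₁ : 1 < α₁) (hα₂ : 1 < α₂)
    (hγ₁ : ∀ j, 0 < γ₁ j) (hγ₂ : ∀ j, 0 < γ₂ j) (d₁ d₂ : ℕ) :
    0 ≤ weightBound b α₁ α₂ γ₁ γ₂ d₁ d₂ := by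
  have h1 := mu_nonneg hb hα₁
  have h2 := zetaReal_nonneg hα₂
  refine mul_nonneg (Finset.prod_nonneg fun j _ => ?_) (Finset.prod_nonneg fun j _ => ?_)
  · have := hγ₁ j
    positivity
  · have := hγ₂ j
    positivity

lemma weightBound_succ_left (d₁ d₂ : ℕ) :
    weightBound b α₁ α₂ γ₁ γ₂ (d₁ + 1) d₂ =
      weightBound b α₁ α₂ γ₁ γ₂ d₁ d₂ * (1 + 2 * γ₁ d₁ * mu b α₁) := by
  rw [weightBound, weightBound, Finset.prod_range_succ]
  ring

lemma weightBound_succ_right (d₁ d₂ : ℕ) :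
    weightBound b α₁ α₂ γ₁ γ₂ d₁ (d₂ + 1) =
      weightBound b α₁ α₂ γ₁ γ₂ d₁ d₂ * (1 + 4 * γ₂ d₂ * zetaReal α₂) := by
  rw [weightBound, weightBound, Finset.prod_range_succ]
  ring

lemma tsum_weight_mul_snoc_left (hb : 0 < b) (hγ₁ : ∀ j, 0 < γ₁ j) (hγ₂ : ∀ j, 0 < γ₂ j)
    (F : (Fin (d₁ + 1) → ℕ) × (Fin d₂ → ℤ) → ℝ≥0∞) :
    ∑' kl, ENNReal.ofReal (weight b α₁ α₂ γ₁ γ₂ kl) * F kl =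
      ∑' kl : (Fin d₁ → ℕ) × (Fin d₂ → ℤ), ENNReal.ofReal (weight b α₁ α₂ γ₁ γ₂ kl) *
        (F (Fin.snoc (α := fun _ => ℕ) kl.1 0, kl.2) + ENNReal.ofReal (γ₁ d₁) *
          ∑' k, ENNReal.ofReal (walDecay b α₁ k) *
            F (Fin.snoc (α := fun _ => ℕ) kl.1 k, kl.2)) := by
  rw [tsum_snoc_left]
  refine tsum_congr fun kl => ?_
  simp only [weight_snoc_left, ENNReal.ofReal_mul (weight_pos hb hγ₁ hγ₂ _).le, mul_assoc]
  rw [ENNReal.tsum_mul_left, tsum_rWal_mul b α₁ (hγ₁ d₁).le]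

lemma tsum_weight_mul_snoc_right (hb : 0 < b) (hγ₁ : ∀ j, 0 < γ₁ j) (hγ₂ : ∀ j, 0 < γ₂ j)
    (F : (Fin d₁ → ℕ) × (Fin (d₂ + 1) → ℤ) → ℝ≥0∞) :
    ∑' kl, ENNReal.ofReal (weight b α₁ α₂ γ₁ γ₂ kl) * F kl =
      ∑' kl : (Fin d₁ → ℕ) × (Fin d₂ → ℤ), ENNReal.ofReal (weight b α₁ α₂ γ₁ γ₂ kl) *
        (F (kl.1, Fin.snoc (α := fun _ => ℤ) kl.2 0) + ENNReal.ofReal (γ₂ d₂) *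
          ∑' l, ENNReal.ofReal (korDecay α₂ l) *
            F (kl.1, Fin.snoc (α := fun _ => ℤ) kl.2 l)) := by
  rw [tsum_snoc_right]
  refine tsum_congr fun kl => ?_
  simp only [weight_snoc_right, ENNReal.ofReal_mul (weight_pos hb hγ₁ hγ₂ _).le, mul_assoc]
  rw [ENNReal.tsum_mul_left, tsum_rKor_mul α₂ (hγ₂ d₂).le]

/-- The sum factorises one coordinate at a time, with factors at most `1 + γμ` and `1 + 2γζ`; these
are weakened to the factors of the final bound. -/
lemma tsum_weight_le (hb : 1 < b) (hα₁ : 1 < α₁) (hα₂ : 1 < α₂)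
    (hγ₁ : ∀ j, 0 < γ₁ j) (hγ₂ : ∀ j, 0 < γ₂ j) (d₁ d₂ : ℕ) :
    ∑' kl : (Fin d₁ → ℕ) × (Fin d₂ → ℤ), ENNReal.ofReal (weight b α₁ α₂ γ₁ γ₂ kl) ≤
      ENNReal.ofReal (weightBound b α₁ α₂ γ₁ γ₂ d₁ d₂) := by
  have hb0 : 0 < b := by omega
  have hμ := mu_nonneg hb hα₁
  have hζ := zetaReal_nonneg hα₂
  induction d₁ with
  | zero =>
    induction d₂ with
    | zero =>
      rw [tsum_eq_single 0 fun kl h => absurd (Subsingleton.elim _ _) h, weight_zero]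
      simp [weightBound]
    | succ d₂ ih =>
      have h := tsum_weight_mul_snoc_right (d₁ := 0) (d₂ := d₂) (α₁ := α₁) (α₂ := α₂)
        hb0 hγ₁ hγ₂ fun _ => 1
      simp only [mul_one] at h
      rw [h, weightBound_succ_right, ENNReal.tsum_mul_right,
        ENNReal.ofReal_mul (weightBound_nonneg hb hα₁ hα₂ hγ₁ hγ₂ _ _)]
      have h2 := (hγ₂ d₂).le
      rw [ENNReal.ofReal_add zero_le_one (by positivity), ENNReal.ofReal_one,
        show 4 * γ₂ d₂ * zetaReal α₂ = γ₂ d₂ * (4 * zetaReal α₂) by ring, ENNReal.ofReal_mul h2]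
      gcongr
      exact (tsum_korDecay_le hα₂).trans (ENNReal.ofReal_le_ofReal (by linarith))
  | succ d₁ ih =>
    have h := tsum_weight_mul_snoc_left (d₁ := d₁) (d₂ := d₂) (α₁ := α₁) (α₂ := α₂)
      hb0 hγ₁ hγ₂ fun _ => 1
    simp only [mul_one] at h
    rw [h, weightBound_succ_left, ENNReal.tsum_mul_right,
      ENNReal.ofReal_mul (weightBound_nonneg hb hα₁ hα₂ hγ₁ hγ₂ _ _)]
    have h2 := (hγ₁ d₁).le
    rw [ENNReal.ofReal_add zero_le_one (by positivity), ENNReal.ofReal_one,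
      show 2 * γ₁ d₁ * mu b α₁ = γ₁ d₁ * (2 * mu b α₁) by ring, ENNReal.ofReal_mul h2]
    gcongr
    exact (tsum_walDecay_le hb hα₁).trans (ENNReal.ofReal_le_ofReal (by linarith))

end Weights

/-! ### Basis functions at points with one more component -/

section Steps

variable {b : ℕ} [Fact b.Prime] {d₁ d₂ : ℕ}

lemma norm_walChar (m k : ℕ) (f h : (ZMod b)[X]) : ‖walChar m k f h‖ = 1 := by
  rw [walChar_apply]
  exact AddChar.norm_apply _ _

lemma basisFun_snoc_left (m : ℕ) (f : (ZMod b)[X]) (g : Fin d₁ → (ZMod b)[X]) (g' : (ZMod b)[X])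
    (y : Fin d₂ → ℝ) (n : ℕ) (k : Fin d₁ → ℕ) (k' : ℕ) (l : Fin d₂ → ℤ) :
    basisFun b (Fin.snoc (α := fun _ => ℕ) k k', l)
      (polyLatticePoint b m f (Fin.snoc (α := fun _ => (ZMod b)[X]) g g') n, y) =
    basisFun b (k, l) (polyLatticePoint b m f g n, y) * walChar m k' f (natPoly b m n * g') := by
  simp only [basisFun, walVec, wal_polyLatticePoint, Fin.prod_univ_castSucc, Fin.snoc_castSucc,
    Fin.snoc_last]
  ring

/-- Dropping the integer part changes the argument by an integer, because `l` is an integer. -/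
lemma ee_mul_fract {N : ℕ} [NeZero N] (l z : ℤ) (n : ℕ) :
    ee (l * Int.fract ((n : ℝ) * (z : ℝ) / (N : ℝ))) =
      ZMod.stdAddChar ((n : ZMod N) * ((l * z : ℤ) : ZMod N)) := by
  have h1 : (l : ℝ) * Int.fract ((n : ℝ) * (z : ℝ) / (N : ℝ)) =
      ((n * (l * z) : ℤ) : ℝ) / N + ((-(l * ⌊(n : ℝ) * (z : ℝ) / (N : ℝ)⌋) : ℤ) : ℝ) := by
    rw [Int.fract]
    push_cast
    ring
  have h2 := ZMod.stdAddChar_coe (N := N) (n * (l * z))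
  have h3 : (((n * (l * z) : ℤ)) : ZMod N) = (n : ZMod N) * ((l * z : ℤ) : ZMod N) := by
    push_cast
    ring
  rw [h1, ee_add, ee_int, mul_one, ← h3, h2, ee]
  congr 1
  push_cast
  ring

omit [Fact b.Prime] in
lemma basisFun_snoc_right {N : ℕ} [NeZero N] (x : Fin d₁ → ℝ) (z : Fin d₂ → ℤ) (z' : ℤ) (n : ℕ)
    (k : Fin d₁ → ℕ) (l : Fin d₂ → ℤ) (l' : ℤ) :
    basisFun b (k, Fin.snoc (α := fun _ => ℤ) l l')
      (x, latticePoint N (Fin.snoc (α := fun _ => ℤ) z z') n) =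
    basisFun b (k, l) (x, latticePoint N z n) *
      ZMod.stdAddChar ((n : ZMod N) * ((l' * z' : ℤ) : ZMod N)) := by
  simp only [basisFun, trigVec_eq_prod, latticePoint, Fin.prod_univ_castSucc, Fin.snoc_castSucc,
    Fin.snoc_last, ee_mul_fract]
  ring

end Steps

/-! ### Averaging over the integer generators -/

/-- Units `z` preserve the gcd with `N`, so solutions of `l z = t` exist only if `gcd(t,N) ∣ l`, and
they lie in one coset of the annihilator of `gcd(l,N)`. -/
lemma card_filter_mul_eq_le {N : ℕ} [NeZero N] {Z : Finset ℤ}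
    (hZ : ∀ z ∈ Z, z ∈ genInt N) (l : ℤ) (t : ZMod N) :
    (Z.filter fun z => ((l * z : ℤ) : ZMod N) = t).card ≤
      if ((Nat.gcd t.val N : ℕ) : ℤ) ∣ l then Nat.gcd t.val N else 0 := by
  set S := Z.filter fun z => ((l * z : ℤ) : ZMod N) = t with hS
  have hN : 0 < N := NeZero.pos N
  rcases S.eq_empty_or_nonempty with hS0 | ⟨z₀, hz₀⟩
  · simp [hS0]
  have hz₀' := Finset.mem_filter.1 (hS ▸ hz₀)
  obtain ⟨_, _, hcop⟩ := hZ z₀ hz₀'.1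
  have hdvd : (N : ℤ) ∣ l * z₀ - t.val := by
    rw [← ZMod.intCast_eq_intCast_iff_dvd_sub, hz₀'.2]
    simp
  have hGl : ((Nat.gcd t.val N : ℕ) : ℤ) ∣ l := by
    have h1 : ((Nat.gcd t.val N : ℕ) : ℤ) ∣ N := by exact_mod_cast Nat.gcd_dvd_right _ _
    have h2 : ((Nat.gcd t.val N : ℕ) : ℤ) ∣ (t.val : ℤ) := by
      exact_mod_cast Nat.gcd_dvd_left _ _
    have h3 : ((Nat.gcd t.val N : ℕ) : ℤ) ∣ l * z₀ := by
      have := dvd_add (h1.trans hdvd) h2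
      rwa [sub_add_cancel] at this
    exact (hcop.symm.of_isCoprime_of_dvd_left h1).dvd_of_dvd_mul_right h3
  rw [if_pos hGl]
  set g := Int.gcd l N with hg
  have hg0 : 0 < g := Int.gcd_pos_of_ne_zero_right _ (by exact_mod_cast hN.ne')
  have hgG : g ≤ Nat.gcd t.val N := by
    refine Nat.le_of_dvd (Nat.gcd_pos_of_pos_right _ hN) (Nat.dvd_gcd ?_ ?_)
    · have h1 : (g : ℤ) ∣ l * z₀ - t.val := (Int.gcd_dvd_right l N).trans hdvd
      have h2 : (g : ℤ) ∣ l * z₀ := (Int.gcd_dvd_left l N).mul_right _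
      have := dvd_sub h2 h1
      rw [sub_sub_cancel] at this
      exact_mod_cast this
    · exact_mod_cast Int.gcd_dvd_right l N
  -- By Bézout, differences of two solutions are killed by `g = gcd(l,N)`, and a cyclic group has at
  -- most `g` such elements. Distinct `z` stay distinct modulo `N` because `1 ≤ z < N`.
  refine le_trans ?_ ((IsAddCyclic.card_nsmul_eq_zero_le (α := ZMod N) hg0).trans hgG)
  refine Finset.card_le_card_of_injOn (fun z => ((z - z₀ : ℤ) : ZMod N)) ?_ ?_
  · intro z hz
    have hz' := Finset.mem_filter.1 (hS ▸ Finset.mem_coe.1 hz)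
    simp only [Finset.coe_filter, Finset.mem_univ, true_and, Set.mem_ofPred_eq]
    have h1 : ((l * (z - z₀) : ℤ) : ZMod N) = 0 := by
      rw [mul_sub, Int.cast_sub, hz'.2, hz₀'.2, sub_self]
    have h2 := congrArg (fun a : ℤ => (a : ZMod N)) (Int.gcd_eq_gcd_ab l N)
    simp only [← hg] at h2
    push_cast at h1 h2 ⊢
    rw [nsmul_eq_mul, h2, ZMod.natCast_self]
    linear_combination Int.cast (Int.gcdA l N) * h1
  · intro z hz z' hz' h
    obtain ⟨h1, h2, _⟩ := hZ z (Finset.mem_filter.1 (hS ▸ Finset.mem_coe.1 hz)).1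
    obtain ⟨h1', h2', _⟩ := hZ z' (Finset.mem_filter.1 (hS ▸ Finset.mem_coe.1 hz')).1
    simp only [Int.cast_sub, sub_left_inj] at h
    rw [ZMod.intCast_eq_intCast_iff, Int.ModEq, Int.emod_eq_of_lt (by omega) h2,
      Int.emod_eq_of_lt (by omega) h2'] at h
    exact h

/-- Grouping the `z` by `t = l z` and exchanging sums leaves, for each `t`, the multiples of `G =
gcd(t,N)` weighted by `G`. That sum is at most `2ζ` uniformly in `t`, and `W` has mass at most `1`.
-/
lemma tsum_korDecay_mul_sum_le {N : ℕ} [NeZero N] {Z : Finset ℤ}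
    (hZ : ∀ z ∈ Z, z ∈ genInt N) {α : ℝ} (hα : 1 < α) {W : ZMod N → ℝ≥0∞} (hW : ∑ t, W t ≤ 1) :
    ∑' l, ENNReal.ofReal (korDecay α l) * ∑ z ∈ Z, W ((l * z : ℤ) : ZMod N) ≤
      ENNReal.ofReal (2 * zetaReal α) := by
  have h1 : ∀ l : ℤ, ∑ z ∈ Z, W ((l * z : ℤ) : ZMod N) ≤
      ∑ t : ZMod N, W t *
        (if ((Nat.gcd t.val N : ℕ) : ℤ) ∣ l then ((Nat.gcd t.val N : ℕ) : ℝ≥0∞) else 0) := by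
    intro l
    rw [← Finset.sum_fiberwise Z (fun z => ((l * z : ℤ) : ZMod N))]
    refine Finset.sum_le_sum fun t _ => ?_
    rw [Finset.sum_congr rfl fun z hz => by rw [(Finset.mem_filter.1 hz).2], Finset.sum_const,
      nsmul_eq_mul, mul_comm]
    refine mul_le_mul_right ?_ _
    exact_mod_cast card_filter_mul_eq_le hZ l t
  calc ∑' l, ENNReal.ofReal (korDecay α l) * ∑ z ∈ Z, W ((l * z : ℤ) : ZMod N)
      ≤ ∑' l, ∑ t : ZMod N, W t * (ENNReal.ofReal (korDecay α l) *
        (if ((Nat.gcd t.val N : ℕ) : ℤ) ∣ l then ((Nat.gcd t.val N : ℕ) : ℝ≥0∞) else 0)) := by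
        refine ENNReal.tsum_le_tsum fun l => (mul_le_mul_right (h1 l) _).trans_eq ?_
        rw [Finset.mul_sum]
        exact Finset.sum_congr rfl fun t _ => mul_left_comm _ _ _
    _ = ∑ t : ZMod N, W t * ∑' l, (ENNReal.ofReal (korDecay α l) *
        (if ((Nat.gcd t.val N : ℕ) : ℤ) ∣ l then ((Nat.gcd t.val N : ℕ) : ℝ≥0∞) else 0)) := by
        rw [Summable.tsum_finsetSum fun _ _ => ENNReal.summable]
        simp only [ENNReal.tsum_mul_left]
    _ ≤ ∑ t : ZMod N, W t * ENNReal.ofReal (2 * zetaReal α) :=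
        Finset.sum_le_sum fun t _ => mul_le_mul_right
          (tsum_korDecay_dvd_le hα (Nat.gcd_pos_of_pos_right _ (NeZero.pos N))) _
    _ ≤ ENNReal.ofReal (2 * zetaReal α) := by
        rw [← Finset.sum_mul]
        exact mul_le_of_le_one_left' hW

/-- Parseval on `ZMod N`. -/
lemma sum_norm_sq_stdAddChar {N : ℕ} [NeZero N] {φ : ℕ → ℂ} (hφ : ∀ n, ‖φ n‖ = 1) :
    ∑ t : ZMod N, ‖(1 / (N : ℂ)) * ∑ n ∈ Finset.range N,
      φ n * ZMod.stdAddChar ((n : ZMod N) * t)‖ ^ 2 = 1 := by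
  have hN := NeZero.pos N
  rw [sum_norm_sq_of_orthogonal Finset.univ hN hφ (fun t n => AddChar.norm_apply _ _),
    Finset.card_univ, ZMod.card, div_self (by positivity)]
  intro n hn n' hn' hne
  have h := AddChar.sum_mulShift ((n : ZMod N) - n') (ZMod.isPrimitive_stdAddChar N)
  rw [if_neg] at h
  · rw [← Nat.cast_zero, ← h]
    refine Finset.sum_congr rfl fun t _ => ?_
    rw [← AddChar.map_neg_eq_conj, ← AddChar.map_add_eq_mul]
    congr 1
    ring
  · rw [sub_eq_zero, ZMod.natCast_eq_natCast_iff']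
    rwa [Nat.mod_eq_of_lt hn, Nat.mod_eq_of_lt hn']

lemma finite_genInt (N : ℕ) : (genInt N).Finite :=
  (Set.finite_Icc (1 : ℤ) N).subset fun _ hz => ⟨hz.1, hz.2.1.le⟩

lemma totient_le_card_genInt {N : ℕ} (hN : 2 ≤ N) :
    N.totient ≤ (finite_genInt N).toFinset.card := by
  rw [Nat.totient_eq_card_coprime]
  refine Finset.card_le_card_of_injOn (fun n : ℕ => (n : ℤ)) ?_ ?_
  · intro n hn
    simp only [Finset.coe_filter, Finset.mem_range, Set.mem_ofPred_eq] at hn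
    simp only [Set.Finite.coe_toFinset, genInt, Set.mem_ofPred_eq]
    refine ⟨?_, by exact_mod_cast hn.1, Nat.isCoprime_iff_coprime.2 hn.2.symm⟩
    have : n ≠ 0 := by
      rintro rfl
      have := hn.2
      rw [Nat.coprime_zero_right] at this
      omega
    omega
  · exact fun n _ n' _ h => Int.ofNat_injective h

/-- Euler's function gives `b^m (1 - 1/b)`, and `b ≥ 2`. This is where the constant `4` instead of
`2` in the integer factors comes from. -/
lemma pow_le_two_mul_card_genInt {b m : ℕ} (hb : b.Prime) (hm : 0 < m) :
    b ^ m ≤ 2 * (finite_genInt (b ^ m)).toFinset.card := by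
  have h2 : 2 ≤ b ^ m := hb.two_le.trans (Nat.le_self_pow hm.ne' b)
  refine le_trans ?_ (Nat.mul_le_mul_left 2 (totient_le_card_genInt h2))
  rw [Nat.totient_prime_pow hb hm]
  obtain ⟨k, rfl⟩ : ∃ k, m = k + 1 := ⟨m - 1, by omega⟩
  obtain ⟨c, rfl⟩ : ∃ c, b = c + 2 := ⟨b - 2, by have := hb.two_le; omega⟩
  rw [pow_succ, Nat.add_sub_cancel, show c + 2 - 1 = c + 1 by omega, mul_left_comm]
  exact Nat.mul_le_mul_left _ (by omega)

/-! ### The component-by-component algorithm -/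

section Algorithm

variable {b : ℕ} [Fact b.Prime] {α₁ α₂ : ℝ} {γ₁ γ₂ : ℕ → ℝ} {m : ℕ} {f : (ZMod b)[X]}
  {d₁ d₂ : ℕ}

/-- The `n`-th point of the hybrid point set with generating vectors `g` and `z`. -/
noncomputable def hybridPoint (m : ℕ) (f : (ZMod b)[X]) (g : Fin d₁ → (ZMod b)[X])
    (z : Fin d₂ → ℤ) (n : ℕ) : (Fin d₁ → ℝ) × (Fin d₂ → ℝ) :=
  (polyLatticePoint b m f g n, latticePoint (b ^ m) z n)

lemma hybridPoint_mem_cube (m : ℕ) (f : (ZMod b)[X]) (g : Fin d₁ → (ZMod b)[X])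
    (z : Fin d₂ → ℤ) (n : ℕ) : hybridPoint m f g z n ∈ cube d₁ d₂ := by
  refine Set.mk_mem_prod (fun j _ => ?_) fun j _ => ⟨Int.fract_nonneg _, Int.fract_lt_one _⟩
  simp only [polyLatticePoint, nu_eq]
  exact ofFracDigits_mem m fun i => ZMod.val_lt _

lemma errSq_add_one (hγ₁ : ∀ j, 0 < γ₁ j) (hγ₂ : ∀ j, 0 < γ₂ j) (g : Fin d₁ → (ZMod b)[X])
    (z : Fin d₂ → ℤ) :
    errSq b α₁ α₂ γ₁ γ₂ m f g z + 1 =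
      meanSqSum b α₁ α₂ γ₁ γ₂ (b ^ m) (hybridPoint m f g z) :=
  worstCaseError_sq_add_one one_lt_of_fact hγ₁ hγ₂ (pow_pos (Fact.out : b.Prime).pos m)
    (hybridPoint_mem_cube m f g z)

lemma norm_mean_le_one {N : ℕ} {φ : ℕ → ℂ} (hφ : ∀ n, ‖φ n‖ = 1) :
    ‖(1 / (N : ℂ)) * ∑ n ∈ Finset.range N, φ n‖ ≤ 1 := by
  rw [norm_mul, norm_div, norm_one, Complex.norm_natCast, one_div_mul_eq_div]
  refine div_le_one_of_le₀ ((norm_sum_le _ _).trans ?_) (Nat.cast_nonneg N)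
  simp [hφ]

lemma nodeMean_snoc_left (g : Fin d₁ → (ZMod b)[X]) (g' : (ZMod b)[X]) (z : Fin d₂ → ℤ)
    (kl : (Fin d₁ → ℕ) × (Fin d₂ → ℤ)) (k : ℕ) :
    nodeMean b (b ^ m) (hybridPoint m f (Fin.snoc (α := fun _ => (ZMod b)[X]) g g') z)
      (Fin.snoc (α := fun _ => ℕ) kl.1 k, kl.2) =
    (1 / ((b ^ m : ℕ) : ℂ)) * ∑ n ∈ Finset.range (b ^ m),
      basisFun b kl (hybridPoint m f g z n) * walChar m k f (natPoly b m n * g') := by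
  simp only [nodeMean, hybridPoint, basisFun_snoc_left]

lemma nodeMean_snoc_left_zero (g : Fin d₁ → (ZMod b)[X]) (g' : (ZMod b)[X]) (z : Fin d₂ → ℤ)
    (kl : (Fin d₁ → ℕ) × (Fin d₂ → ℤ)) :
    nodeMean b (b ^ m) (hybridPoint m f (Fin.snoc (α := fun _ => (ZMod b)[X]) g g') z)
      (Fin.snoc (α := fun _ => ℕ) kl.1 0, kl.2) =
    nodeMean b (b ^ m) (hybridPoint m f g z) kl := by
  have h : ∀ h, walChar m 0 f h = 1 := by
    intro h
    rw [walChar_apply, ← wal_nu, wal_zero]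
  simp only [nodeMean_snoc_left, h, mul_one]
  rfl

lemma nodeMean_snoc_right (g : Fin d₁ → (ZMod b)[X]) (z : Fin d₂ → ℤ) (z' : ℤ)
    (kl : (Fin d₁ → ℕ) × (Fin d₂ → ℤ)) (l : ℤ) :
    nodeMean b (b ^ m) (hybridPoint m f g (Fin.snoc (α := fun _ => ℤ) z z'))
      (kl.1, Fin.snoc (α := fun _ => ℤ) kl.2 l) =
    (1 / ((b ^ m : ℕ) : ℂ)) * ∑ n ∈ Finset.range (b ^ m),
      basisFun b kl (hybridPoint m f g z n) *
        ZMod.stdAddChar ((n : ZMod (b ^ m)) * ((l * z' : ℤ) : ZMod (b ^ m))) := by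
  simp only [nodeMean, hybridPoint, basisFun_snoc_right]

lemma nodeMean_snoc_right_zero (g : Fin d₁ → (ZMod b)[X]) (z : Fin d₂ → ℤ) (z' : ℤ)
    (kl : (Fin d₁ → ℕ) × (Fin d₂ → ℤ)) :
    nodeMean b (b ^ m) (hybridPoint m f g (Fin.snoc (α := fun _ => ℤ) z z'))
      (kl.1, Fin.snoc (α := fun _ => ℤ) kl.2 0) =
    nodeMean b (b ^ m) (hybridPoint m f g z) kl := by
  simp only [nodeMean_snoc_right, zero_mul, Int.cast_zero, mul_zero, AddChar.map_zero_eq_one,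
    mul_one]
  rfl

lemma sum_ofReal_norm_sq_walChar_le (hf : Irreducible f) (hdeg : f.natDegree = m) (k : ℕ)
    {φ : ℕ → ℂ} (hφ : ∀ n, ‖φ n‖ = 1) :
    ∑ g : Polynomial.degreeLT (ZMod b) m, ENNReal.ofReal (‖(1 / ((b ^ m : ℕ) : ℂ)) *
      ∑ n ∈ Finset.range (b ^ m), φ n * walChar m k f (natPoly b m n * g)‖ ^ 2) ≤
      1 + if b ^ m ∣ k then ((b ^ m : ℕ) : ℝ≥0∞) else 0 := by
  split_ifs with hk
  -- Trivial bound: each of the `b^m` means has modulus at most `1`.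
  · refine le_add_left ?_
    refine (Finset.sum_le_card_nsmul _ _ 1 fun g _ => ?_).trans_eq ?_
    · rw [← ENNReal.ofReal_one]
      refine ENNReal.ofReal_le_ofReal (pow_le_one₀ (norm_nonneg _) (norm_mean_le_one fun n => ?_))
      rw [norm_mul, hφ, norm_walChar, one_mul]
    · rw [Finset.card_univ, card_degreeLT, nsmul_eq_mul, mul_one]
  · rw [← ENNReal.ofReal_sum_of_nonneg fun g _ => by positivity, sum_norm_sq_walChar hf hdeg hk hφ]
    simp

/-- The slice `k = 0` reproduces the old sum for every candidate. On the others the mean-square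
bound `1 + N·[N ∣ k]` is summed against the decay, one `μ` from each part. -/
lemma sum_meanSqSum_snoc_left_le (hf : Irreducible f) (hdeg : f.natDegree = m) (hα₁ : 1 < α₁)
    (hγ₁ : ∀ j, 0 < γ₁ j) (hγ₂ : ∀ j, 0 < γ₂ j)
    (g : Fin d₁ → (ZMod b)[X]) (z : Fin d₂ → ℤ) :
    ∑ g' : Polynomial.degreeLT (ZMod b) m, meanSqSum b α₁ α₂ γ₁ γ₂ (b ^ m)
        (hybridPoint m f (Fin.snoc (α := fun _ => (ZMod b)[X]) g g') z) ≤
      ((b ^ m : ℕ) : ℝ≥0∞) * meanSqSum b α₁ α₂ γ₁ γ₂ (b ^ m) (hybridPoint m f g z) +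
        ENNReal.ofReal (γ₁ d₁ * (2 * mu b α₁)) *
          ∑' kl : (Fin d₁ → ℕ) × (Fin d₂ → ℤ), ENNReal.ofReal (weight b α₁ α₂ γ₁ γ₂ kl) := by
  have hb : 1 < b := one_lt_of_fact
  simp only [meanSqSum, tsum_weight_mul_snoc_left (by omega : 0 < b) hγ₁ hγ₂,
    nodeMean_snoc_left_zero]
  rw [← Summable.tsum_finsetSum fun _ _ => ENNReal.summable, ← ENNReal.tsum_mul_left,
    ← ENNReal.tsum_mul_left, ← ENNReal.tsum_add]
  refine ENNReal.tsum_le_tsum fun kl => ?_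
  rw [← Finset.mul_sum, Finset.sum_add_distrib, Finset.sum_const, Finset.card_univ, card_degreeLT,
    nsmul_eq_mul, mul_add, mul_left_comm, mul_comm (ENNReal.ofReal (γ₁ d₁ * _)), ← Finset.mul_sum,
    ENNReal.ofReal_mul (hγ₁ d₁).le]
  refine add_le_add_right (mul_le_mul_right (mul_le_mul_right ?_ _) _) _
  rw [← Summable.tsum_finsetSum fun _ _ => ENNReal.summable]
  simp only [← Finset.mul_sum, nodeMean_snoc_left]
  refine (ENNReal.tsum_le_tsum fun k => mul_le_mul_right
    (sum_ofReal_norm_sq_walChar_le hf hdeg k fun n => norm_basisFun b kl _) _).trans ?_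
  simp only [mul_add, mul_one]
  rw [ENNReal.tsum_add, two_mul, ENNReal.ofReal_add (mu_nonneg hb hα₁) (mu_nonneg hb hα₁)]
  exact add_le_add (tsum_walDecay_le hb hα₁) (tsum_walDecay_dvd_le hb hα₁ m)

lemma sum_meanSqSum_snoc_right_le (hα₂ : 1 < α₂)
    (hγ₁ : ∀ j, 0 < γ₁ j) (hγ₂ : ∀ j, 0 < γ₂ j) {Z : Finset ℤ} (hZ : ∀ z ∈ Z, z ∈ genInt (b ^ m))
    (g : Fin d₁ → (ZMod b)[X]) (z : Fin d₂ → ℤ) :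
    ∑ z' ∈ Z, meanSqSum b α₁ α₂ γ₁ γ₂ (b ^ m)
        (hybridPoint m f g (Fin.snoc (α := fun _ => ℤ) z z')) ≤
      (Z.card : ℝ≥0∞) * meanSqSum b α₁ α₂ γ₁ γ₂ (b ^ m) (hybridPoint m f g z) +
        ENNReal.ofReal (γ₂ d₂ * (2 * zetaReal α₂)) *
          ∑' kl : (Fin d₁ → ℕ) × (Fin d₂ → ℤ), ENNReal.ofReal (weight b α₁ α₂ γ₁ γ₂ kl) := by
  have hb : 1 < b := one_lt_of_fact
  simp only [meanSqSum, tsum_weight_mul_snoc_right (by omega : 0 < b) hγ₁ hγ₂,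
    nodeMean_snoc_right_zero]
  rw [← Summable.tsum_finsetSum fun _ _ => ENNReal.summable, ← ENNReal.tsum_mul_left,
    ← ENNReal.tsum_mul_left, ← ENNReal.tsum_add]
  refine ENNReal.tsum_le_tsum fun kl => ?_
  rw [← Finset.mul_sum, Finset.sum_add_distrib, Finset.sum_const,
    nsmul_eq_mul, mul_add, mul_left_comm, mul_comm (ENNReal.ofReal (γ₂ d₂ * _)), ← Finset.mul_sum,
    ENNReal.ofReal_mul (hγ₂ d₂).le]
  refine add_le_add_right (mul_le_mul_right (mul_le_mul_right ?_ _) _) _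
  rw [← Summable.tsum_finsetSum fun _ _ => ENNReal.summable]
  simp only [← Finset.mul_sum, nodeMean_snoc_right]
  refine tsum_korDecay_mul_sum_le hZ hα₂ (W := fun t => ENNReal.ofReal (‖(1 / ((b ^ m : ℕ) : ℂ)) *
    ∑ n ∈ Finset.range (b ^ m), basisFun b kl (hybridPoint m f g z n) *
      ZMod.stdAddChar ((n : ZMod (b ^ m)) * t)‖ ^ 2)) ?_
  rw [← ENNReal.ofReal_sum_of_nonneg fun t _ => by positivity,
    sum_norm_sq_stdAddChar fun n => norm_basisFun b kl _, ENNReal.ofReal_one]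

/-- A minimal value is at most a mean. -/
lemma le_of_card_mul_add_one_le {E A : ℝ≥0∞} {c : ℕ} (hc : 0 < c) {B : ℝ}
    (h : (c : ℝ≥0∞) * (E + 1) ≤ c * (A + 1) + ENNReal.ofReal B) :
    E ≤ A + ENNReal.ofReal (B / c) := by
  have hc0 : (c : ℝ≥0∞) ≠ 0 := by exact_mod_cast hc.ne'
  have h1 : ENNReal.ofReal B = c * ENNReal.ofReal (B / c) := by
    rw [← ENNReal.ofReal_natCast, ← ENNReal.ofReal_mul (Nat.cast_nonneg c)]
    congr 1
    field_simp
  -- Only the finite quantities `c` and `1` are cancelled; `E` and `A` may be infinite.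
  rw [h1, ← mul_add, ENNReal.mul_le_mul_iff_right hc0 (ENNReal.natCast_ne_top c),
    add_right_comm] at h
  exact (ENNReal.add_le_add_iff_right ENNReal.one_ne_top).1 h

lemma errSq_snoc_left_le (hf : Irreducible f) (hdeg : f.natDegree = m) (hα₁ : 1 < α₁)
    (hα₂ : 1 < α₂) (hγ₁ : ∀ j, 0 < γ₁ j) (hγ₂ : ∀ j, 0 < γ₂ j)
    (g : Fin d₁ → (ZMod b)[X]) (z : Fin d₂ → ℤ) {gNew : (ZMod b)[X]}
    (hmin : ∀ g' ∈ genPoly b m,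
      errSq b α₁ α₂ γ₁ γ₂ m f (Fin.snoc (α := fun _ => (ZMod b)[X]) g gNew) z ≤
        errSq b α₁ α₂ γ₁ γ₂ m f (Fin.snoc (α := fun _ => (ZMod b)[X]) g g') z) :
    errSq b α₁ α₂ γ₁ γ₂ m f (Fin.snoc (α := fun _ => (ZMod b)[X]) g gNew) z ≤
      errSq b α₁ α₂ γ₁ γ₂ m f g z + ENNReal.ofReal
        (2 * γ₁ d₁ * mu b α₁ * weightBound b α₁ α₂ γ₁ γ₂ d₁ d₂ / (b : ℝ) ^ m) := by
  have hb : 1 < b := one_lt_of_fact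
  have hμ := mu_nonneg hb hα₁
  have hγ := (hγ₁ d₁).le
  have hB := weightBound_nonneg hb hα₁ hα₂ hγ₁ hγ₂ d₁ d₂
  have key := le_of_card_mul_add_one_le (c := b ^ m) (pow_pos (by omega) m)
    (B := 2 * γ₁ d₁ * mu b α₁ * weightBound b α₁ α₂ γ₁ γ₂ d₁ d₂)
    (E := errSq b α₁ α₂ γ₁ γ₂ m f (Fin.snoc (α := fun _ => (ZMod b)[X]) g gNew) z)
    (A := errSq b α₁ α₂ γ₁ γ₂ m f g z) ?_
  · simpa using key
  · have h1 := Finset.card_nsmul_le_sum (Finset.univ : Finset (Polynomial.degreeLT (ZMod b) m))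
      (fun g' => errSq b α₁ α₂ γ₁ γ₂ m f (Fin.snoc (α := fun _ => (ZMod b)[X]) g g') z + 1)
      (errSq b α₁ α₂ γ₁ γ₂ m f (Fin.snoc (α := fun _ => (ZMod b)[X]) g gNew) z + 1)
      (fun g' _ => add_le_add_left (hmin g' (Polynomial.mem_degreeLT.1 g'.2)) 1)
    rw [Finset.card_univ, card_degreeLT, nsmul_eq_mul] at h1
    refine h1.trans ?_
    simp only [errSq_add_one hγ₁ hγ₂]
    refine (sum_meanSqSum_snoc_left_le hf hdeg hα₁ hγ₁ hγ₂ g z).trans (add_le_add_right ?_ _)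
    rw [show 2 * γ₁ d₁ * mu b α₁ * weightBound b α₁ α₂ γ₁ γ₂ d₁ d₂ =
      γ₁ d₁ * (2 * mu b α₁) * weightBound b α₁ α₂ γ₁ γ₂ d₁ d₂ by ring,
      ENNReal.ofReal_mul (p := γ₁ d₁ * (2 * mu b α₁)) (by positivity)]
    exact mul_le_mul_right (tsum_weight_le hb hα₁ hα₂ hγ₁ hγ₂ d₁ d₂) _

lemma errSq_snoc_right_le (hm : 0 < m) (hα₁ : 1 < α₁)
    (hα₂ : 1 < α₂) (hγ₁ : ∀ j, 0 < γ₁ j) (hγ₂ : ∀ j, 0 < γ₂ j)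
    (g : Fin d₁ → (ZMod b)[X]) (z : Fin d₂ → ℤ) {zNew : ℤ}
    (hmin : ∀ z' ∈ genInt (b ^ m),
      errSq b α₁ α₂ γ₁ γ₂ m f g (Fin.snoc (α := fun _ => ℤ) z zNew) ≤
        errSq b α₁ α₂ γ₁ γ₂ m f g (Fin.snoc (α := fun _ => ℤ) z z')) :
    errSq b α₁ α₂ γ₁ γ₂ m f g (Fin.snoc (α := fun _ => ℤ) z zNew) ≤
      errSq b α₁ α₂ γ₁ γ₂ m f g z + ENNReal.ofReal
        (4 * γ₂ d₂ * zetaReal α₂ * weightBound b α₁ α₂ γ₁ γ₂ d₁ d₂ / (b : ℝ) ^ m) := by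
  have hb : 1 < b := one_lt_of_fact
  have hbm : 0 < b ^ m := pow_pos (by omega) m
  have hζ := zetaReal_nonneg hα₂
  have hγ := (hγ₂ d₂).le
  have hB := weightBound_nonneg hb hα₁ hα₂ hγ₁ hγ₂ d₁ d₂
  set Z := (finite_genInt (b ^ m)).toFinset with hZ
  have hcard : b ^ m ≤ 2 * Z.card := pow_le_two_mul_card_genInt Fact.out hm
  have hmem : ∀ z' ∈ Z, z' ∈ genInt (b ^ m) := fun z' h => by simpa [hZ] using h
  have key := le_of_card_mul_add_one_le (c := Z.card) (by omega)
    (B := γ₂ d₂ * (2 * zetaReal α₂) * weightBound b α₁ α₂ γ₁ γ₂ d₁ d₂)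
    (E := errSq b α₁ α₂ γ₁ γ₂ m f g (Fin.snoc (α := fun _ => ℤ) z zNew))
    (A := errSq b α₁ α₂ γ₁ γ₂ m f g z) ?_
  · refine key.trans (add_le_add_right (ENNReal.ofReal_le_ofReal ?_) _)
    have hZ0 : (0 : ℝ) < Z.card := by
      exact_mod_cast (by omega : 0 < Z.card)
    have hN0 : (0 : ℝ) < (b : ℝ) ^ m := by exact_mod_cast hbm
    have hc : (b : ℝ) ^ m ≤ 2 * Z.card := by exact_mod_cast hcard
    rw [div_le_div_iff₀ hZ0 hN0]
    have hX : 0 ≤ γ₂ d₂ * (2 * zetaReal α₂) * weightBound b α₁ α₂ γ₁ γ₂ d₁ d₂ := by positivity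
    calc _ ≤ γ₂ d₂ * (2 * zetaReal α₂) * weightBound b α₁ α₂ γ₁ γ₂ d₁ d₂ * (2 * Z.card) :=
          mul_le_mul_of_nonneg_left hc hX
      _ = _ := by ring
  · have h1 := Finset.card_nsmul_le_sum Z
      (fun z' => errSq b α₁ α₂ γ₁ γ₂ m f g (Fin.snoc (α := fun _ => ℤ) z z') + 1)
      (errSq b α₁ α₂ γ₁ γ₂ m f g (Fin.snoc (α := fun _ => ℤ) z zNew) + 1)
      (fun z' h => add_le_add_left (hmin z' (hmem z' h)) 1)
    rw [nsmul_eq_mul] at h1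
    refine h1.trans ?_
    simp only [errSq_add_one hγ₁ hγ₂]
    refine (sum_meanSqSum_snoc_right_le hα₂ hγ₁ hγ₂ hmem g z).trans (add_le_add_right ?_ _)
    rw [ENNReal.ofReal_mul (p := γ₂ d₂ * (2 * zetaReal α₂)) (by positivity)]
    exact mul_le_mul_right (tsum_weight_le hb hα₁ hα₂ hγ₁ hγ₂ d₁ d₂) _

/-- The error of the one-dimensional polynomial lattice with generator `1`. -/
lemma errSq_one_le (hf : Irreducible f) (hdeg : f.natDegree = m) (hα₁ : 1 < α₁)
    (hγ₁ : ∀ j, 0 < γ₁ j) (hγ₂ : ∀ j, 0 < γ₂ j) (z : Fin 0 → ℤ) :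
    errSq b α₁ α₂ γ₁ γ₂ m f (fun _ : Fin 1 => 1) z ≤
      ENNReal.ofReal (γ₁ 0 * mu b α₁ / (b : ℝ) ^ m) := by
  have hb : 1 < b := one_lt_of_fact
  have hμ := mu_nonneg hb hα₁
  have hbm : 0 < b ^ m := pow_pos (by omega) m
  have hg : (fun _ : Fin 1 => (1 : (ZMod b)[X])) =
      Fin.snoc (α := fun _ => (ZMod b)[X]) (Fin.elim0 : Fin 0 → (ZMod b)[X]) 1 := by
    funext j
    rw [Subsingleton.elim j (Fin.last 0), Fin.snoc_last]
  have key := le_of_card_mul_add_one_le (c := b ^ m) hbm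
    (B := γ₁ 0 * mu b α₁) (A := 0)
    (E := errSq b α₁ α₂ γ₁ γ₂ m f (fun _ : Fin 1 => 1) z) ?_
  · simpa using key
  rw [errSq_add_one hγ₁ hγ₂, hg, meanSqSum,
    tsum_weight_mul_snoc_left (by omega : 0 < b) hγ₁ hγ₂,
    tsum_eq_single 0 fun kl h => absurd (Subsingleton.elim _ _) h, weight_zero,
    nodeMean_snoc_left_zero, nodeMean_zero hbm]
  simp only [ENNReal.ofReal_one, one_mul, norm_one, one_pow, zero_add, mul_add, mul_one]
  refine add_le_add_right ?_ _
  rw [mul_left_comm, ENNReal.ofReal_mul (hγ₁ 0).le, ← ENNReal.tsum_mul_left]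
  refine mul_le_mul_right ((ENNReal.tsum_le_tsum fun k => ?_).trans
    (tsum_walDecay_dvd_le hb hα₁ m)) _
  rw [mul_left_comm]
  refine mul_le_mul_right ?_ _
  rw [nodeMean_snoc_left (kl := (0 : (Fin 0 → ℕ) × (Fin 0 → ℤ)))]
  simp only [basisFun_zero, one_mul, mul_one]
  -- With generator `1` the mean of `wal_k` vanishes unless `b^m ∣ k`, so only the sparse part of
  -- the decay sum remains.
  split_ifs with hk
  · refine mul_le_of_le_one_right' ?_
    rw [← ENNReal.ofReal_one]
    exact ENNReal.ofReal_le_ofReal (pow_le_one₀ (norm_nonneg _)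
      (norm_mean_le_one fun n => norm_walChar _ _ _ _))
  · rw [sum_walChar_natPoly hf hdeg hk]
    simp

lemma errSq_le_of_CBC (hf : Irreducible f) (hdeg : f.natDegree = m) (hα₁ : 1 < α₁)
    (hα₂ : 1 < α₂) (hγ₁ : ∀ j, 0 < γ₁ j) (hγ₂ : ∀ j, 0 < γ₂ j) {s₁ s₂ : ℕ}
    {g : Fin d₁ → (ZMod b)[X]} {z : Fin d₂ → ℤ} (h : CBC b α₁ α₂ γ₁ γ₂ m f s₁ s₂ d₁ d₂ g z) :
    errSq b α₁ α₂ γ₁ γ₂ m f g z ≤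
      ENNReal.ofReal (2 / (b : ℝ) ^ m * weightBound b α₁ α₂ γ₁ γ₂ d₁ d₂) := by
  have hb : 1 < b := one_lt_of_fact
  have hm : 0 < m := hdeg ▸ hf.natDegree_pos
  have hμ := mu_nonneg hb hα₁
  have hζ := zetaReal_nonneg hα₂
  have hN : (0 : ℝ) < (b : ℝ) ^ m := by positivity
  have hB := weightBound_nonneg hb hα₁ hα₂ hγ₁ hγ₂
  induction h with
  | start z₁ hz hmin =>
    have hsnoc : ∀ z : ℤ, (fun _ : Fin 1 => z) =
        Fin.snoc (α := fun _ => ℤ) (Fin.elim0 : Fin 0 → ℤ) z := by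
      intro z
      funext j
      rw [Subsingleton.elim j (Fin.last 0), Fin.snoc_last]
    simp only [hsnoc] at hmin ⊢
    -- The initial minimization is viewed as an integer step from dimensions `(1, 0)`, although no
    -- run visits that stage.
    refine (errSq_snoc_right_le hm hα₁ hα₂ hγ₁ hγ₂ _ _ hmin).trans ?_
    have h1 := (hγ₁ 0).le
    have h2 := (hγ₂ 0).le
    have h3 := hB 1 0
    refine (add_le_add_left (errSq_one_le hf hdeg hα₁ hγ₁ hγ₂ _) _).trans ?_
    rw [← ENNReal.ofReal_add (by positivity) (by positivity)]
    refine ENNReal.ofReal_le_ofReal ?_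
    have hx : 0 ≤ γ₁ 0 * mu b α₁ := by positivity
    have hy : 0 ≤ γ₂ 0 * zetaReal α₂ := by positivity
    rw [← add_div, div_mul_eq_mul_div]
    refine div_le_div_of_nonneg_right ?_ hN.le
    simp only [weightBound, Finset.prod_range_one, Finset.prod_range_zero, mul_one]
    nlinarith [mul_nonneg hx hy]
  | @extendPoly d₁ d₂ g z _ _ gNew _ hmin ih =>
    refine (errSq_snoc_left_le hf hdeg hα₁ hα₂ hγ₁ hγ₂ g z hmin).trans
      ((add_le_add_left ih _).trans ?_)
    have h1 := (hγ₁ d₁).le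
    have h3 := hB d₁ d₂
    rw [← ENNReal.ofReal_add (by positivity) (by positivity), weightBound_succ_left]
    refine ENNReal.ofReal_le_ofReal ?_
    rw [div_mul_eq_mul_div, div_mul_eq_mul_div, ← add_div]
    refine div_le_div_of_nonneg_right ?_ hN.le
    have : 0 ≤ γ₁ d₁ * mu b α₁ * weightBound b α₁ α₂ γ₁ γ₂ d₁ d₂ := by positivity
    -- The increment is half of what the new factor adds to the bound; the integer step has the same
    -- slack.
    linarith
  | @extendInt d₁ d₂ g z _ _ zNew _ hmin ih =>
    refine (errSq_snoc_right_le hm hα₁ hα₂ hγ₁ hγ₂ g z hmin).trans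
      ((add_le_add_left ih _).trans ?_)
    have h1 := (hγ₂ d₂).le
    have h3 := hB d₁ d₂
    rw [← ENNReal.ofReal_add (by positivity) (by positivity), weightBound_succ_right]
    refine ENNReal.ofReal_le_ofReal ?_
    rw [div_mul_eq_mul_div, div_mul_eq_mul_div, ← add_div]
    refine div_le_div_of_nonneg_right ?_ hN.le
    have : 0 ≤ γ₂ d₂ * zetaReal α₂ * weightBound b α₁ α₂ γ₁ γ₂ d₁ d₂ := by positivity
    linarith

lemma finite_genPoly (m : ℕ) : (genPoly b m).Finite := by
  have h : genPoly b m = Set.range (Subtype.val : Polynomial.degreeLT (ZMod b) m → (ZMod b)[X]) := by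
    ext p
    rw [Subtype.range_coe]
    exact Polynomial.mem_degreeLT.symm
  rw [h]
  exact Set.finite_range _

lemma genInt_nonempty (hm : 0 < m) : (genInt (b ^ m)).Nonempty := by
  refine ⟨1, le_rfl, ?_, isCoprime_one_left⟩
  exact_mod_cast Nat.one_lt_pow hm.ne' one_lt_of_fact

/-- Minimizers exist because the candidate sets are finite and nonempty. The run built here makes
all integer steps before the polynomial ones. -/
lemma exists_CBC (hm : 0 < m) {s₁ s₂ : ℕ} (hd₁ : 1 ≤ d₁) (hds₁ : d₁ ≤ s₁) (hd₂ : 1 ≤ d₂)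
    (hds₂ : d₂ ≤ s₂) : ∃ (g : Fin d₁ → (ZMod b)[X]) (z : Fin d₂ → ℤ),
      CBC b α₁ α₂ γ₁ γ₂ m f s₁ s₂ d₁ d₂ g z := by
  induction d₁, hd₁ using Nat.le_induction with
  | base =>
    induction d₂, hd₂ using Nat.le_induction with
    | base =>
      obtain ⟨z₁, hz₁, hmin⟩ := Set.exists_min_image (genInt (b ^ m))
        (fun z => errSq b α₁ α₂ γ₁ γ₂ m f (fun _ : Fin 1 => 1) (fun _ : Fin 1 => z))
        (finite_genInt _) (genInt_nonempty hm)
      exact ⟨_, _, CBC.start z₁ hz₁ hmin⟩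
    | succ d₂ _ ih =>
      obtain ⟨g, z, h⟩ := ih (by omega)
      obtain ⟨zNew, hz, hmin⟩ := Set.exists_min_image (genInt (b ^ m))
        (fun z' => errSq b α₁ α₂ γ₁ γ₂ m f g (Fin.snoc (α := fun _ => ℤ) z z'))
        (finite_genInt _) (genInt_nonempty hm)
      exact ⟨_, _, CBC.extendInt g z h (by omega) zNew hz hmin⟩
  | succ d₁ _ ih =>
    obtain ⟨g, z, h⟩ := ih (by omega)
    obtain ⟨gNew, hg, hmin⟩ := Set.exists_min_image (genPoly b m)
      (fun g' => errSq b α₁ α₂ γ₁ γ₂ m f (Fin.snoc (α := fun _ => (ZMod b)[X]) g g') z)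
      (finite_genPoly m) ⟨0, by simp [genPoly]⟩
    exact ⟨_, _, CBC.extendPoly g z h (by omega) gNew hg hmin⟩

end Algorithm

end HybridCBC

theorem theorem3 (b : ℕ) [Fact b.Prime] (m : ℕ) (f : Polynomial (ZMod b))
    (hf : Irreducible f) (hdeg : f.natDegree = m)
    (α₁ α₂ : ℝ) (hα₁ : 1 < α₁) (hα₂ : 1 < α₂)
    (γ₁ γ₂ : ℕ → ℝ) (hγ₁ : ∀ j, 0 < γ₁ j) (hγ₂ : ∀ j, 0 < γ₂ j)
    (hanti₁ : Antitone γ₁) (hanti₂ : Antitone γ₂)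
    (s₁ s₂ d₁ d₂ : ℕ) (hd₁ : 1 ≤ d₁) (hds₁ : d₁ ≤ s₁) (hd₂ : 1 ≤ d₂) (hds₂ : d₂ ≤ s₂) :
    (∃ (g : Fin d₁ → Polynomial (ZMod b)) (z : Fin d₂ → ℤ),
      HybridCBC.CBC b α₁ α₂ γ₁ γ₂ m f s₁ s₂ d₁ d₂ g z) ∧
    ∀ (g : Fin d₁ → Polynomial (ZMod b)) (z : Fin d₂ → ℤ),
      HybridCBC.CBC b α₁ α₂ γ₁ γ₂ m f s₁ s₂ d₁ d₂ g z →
      HybridCBC.errSq b α₁ α₂ γ₁ γ₂ m f g z ≤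
        ENNReal.ofReal (2 / ((b : ℝ) ^ m) *
          (∏ j ∈ Finset.range d₁, (1 + 2 * γ₁ j * HybridCBC.mu b α₁)) *
          (∏ j ∈ Finset.range d₂, (1 + 4 * γ₂ j * HybridCBC.zetaReal α₂))) := by
  refine ⟨HybridCBC.exists_CBC (hdeg ▸ hf.natDegree_pos) hd₁ hds₁ hd₂ hds₂, fun g z h => ?_⟩
  rw [mul_assoc]
  exact HybridCBC.errSq_le_of_CBC hf hdeg hα₁ hα₂ hγ₁ hγ₂ h
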